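/- **Model.** Let $1\le n<K$, $N\ge 1$. A network joins each user $i\in[N]$ to a set $\mathcal H_i\subseteq[K]$ of $n$ relays; $\mathcal U_j=\{i: j\in\mathcal H_i\}$ is the set of the users joined to relay $j$, and $|\mathcal U_j|=m$ for every $j$, so that $Nn=Km$. In the *multiple cyclic network*, $K\mid N$ and $\mathcal H_i$ consists of the relays $i,i-1,\dots,i-n+1$ modulo $K$. All random variables are finitely valued and entropies $H(\cdot)$ are in $q$-ary units. An *aggregation scheme* over a finite field $\mathbb F_q$ consists of inputs $W_1,\dots,W_N$, independent and uniform on $\mathbb F_q^L$ for some $L\ge 1$; individual keys $Z_i\in\mathbb F_q^{L_Z}$ that are functions of a source key $Z_\Sigma\in\mathbb F_q^{L_{Z_\Sigma}}$, where $L_{Z_\Sigma}=H(Z_1,\dots,Z_N)$, and with $(Z_1,\dots,Z_N)$ independent of $(W_1,\dots,W_N)$; messages $X_{i,j}$ ($j\in\mathcal H_i$) from user $i$ to relay $j$ with $H(\{X_{i,j}\}_{j\in\mathcal H_i}\mid W_i,Z_i)=0$; and messages $Y_j$ from relay $j$ to the server with $H(Y_j\mid\{X_{i,j}\}_{i\in\mathcal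 U_j})=0$. It is *$(0,T_h,T_u)$-secure* if $H(\sum_i W_i\mid Y_1,\dots,Y_K)=0$ and $$I\bigl(W_{[N]};\{X_{i,j}: i\in\mathcal U_j\}_{j\in\mathcal T_h}\,\big|\,\{W_i,Z_i\}_{i\in\mathcal T_u}\bigr)=0$$ for all $\mathcal T_h\subseteq[K]$, $\mathcal T_u\subseteq[N]$ with $|\mathcal T_h|\le T_h$, $|\mathcal T_u|\le T_u$. Its rates are $R_X=\max_{i,\,j\in\mathcal H_i}H(X_{i,j})/L$, $R_Y=\max_j H(Y_j)/L$, $R_Z=L_Z/L$ and $R_{Z_\Sigma}=L_{Z_\Sigma}/L$. For $T_h\le K-n$ put $$n(\mathcal N,T_h)=\min\Bigl\{\Bigl|\bigcup_{j\in\mathcal H}\mathcal U_j\Bigr| : \mathcal H\subseteq[K],\ |\mathcal H|=K-T_h-n+1\Bigr\}.$$ **Theorem.** Let $\mathcal N$ be a multiple cyclic network with $N$ users, $K$ relays, $n$ relays per user and $m=Nn/K$ users per relay. Let $T_u\ge 0$ satisfy $T_u\le n(\mathcal N,1)-1$ and $T_u+m\le\min\{N-1,K-n\}$. Then, for every finite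 field $\mathbb F_q$: 1. there is a $(0,1,T_u)$-secure scheme over $\mathbb F_q$ (for a suitable input length $L$) with $$R_X=R_Y=\frac1n,\qquad R_Z=\frac1n,\qquad R_{Z_\Sigma}=\frac{T_u+m}{n};$$ 2. these rates are optimal: every $(0,1,T_u)$-secure scheme over $\mathbb F_q$ on $\mathcal N$ has $R_X\ge\frac1n$ and $R_Y\ge\frac1n$, and if $R_X=R_Y=\frac1n$, then $R_Z\ge\frac1n$ and $R_{Z_\Sigma}\ge\frac{T_u+m}{n}$. -/

import Mathlib

universe u

namespace HSA

noncomputable section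

/-! ### Shannon information measures of finitely valued random variables

Logarithms are to the base `q`, so entropies are measured in `q`-ary units. -/

/-- Entropy `H(X)` of a random variable `X : Ω → α` with values in a finite set, to base `q`. -/
def entropy (q : ℕ) {Ω α : Type*} [Fintype α] (μ : PMF Ω) (X : Ω → α) : ℝ :=
  (∑ a : α, Real.negMulLog ((μ.map X) a).toReal) / Real.log q

/-- Conditional entropy `H(X | Y) = H(X, Y) - H(Y)`. -/
def condEntropy (q : ℕ) {Ω α β : Type*} [Fintype α] [Fintype β] (μ : PMF Ω)
    (X : Ω → α) (Y : Ω → β) : ℝ :=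
  entropy q μ (fun ω => (X ω, Y ω)) - entropy q μ Y

/-- Conditional mutual information `I(X ; Y | T) = H(X | T) - H(X | Y, T)`. -/
def condMutualInfo (q : ℕ) {Ω α β γ : Type*} [Fintype α] [Fintype β] [Fintype γ] (μ : PMF Ω)
    (X : Ω → α) (Y : Ω → β) (T : Ω → γ) : ℝ :=
  condEntropy q μ X T - condEntropy q μ X (fun ω => (Y ω, T ω))

/-! ### Networks

A three-layer network with users `Fin N` and relays `Fin K` is given by the sets
`H i` of the relays connected to user `i`. -/

/-- The set `U_j` of the users connected to relay `j`. -/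
def users {N K : ℕ} (H : Fin N → Finset (Fin K)) (j : Fin K) : Finset (Fin N) :=
  Finset.univ.filter (fun i => j ∈ H i)

/-- `n(𝒩, T_h)`: the minimum, over all sets of `K - T_h - n + 1` relays, of the number of
users connected to at least one relay of the set (used for `T_h ≤ K - n`). -/
def minUsers {N K : ℕ} (H : Fin N → Finset (Fin K)) (n Th : ℕ) : ℕ :=
  sInf {c : ℕ | ∃ R : Finset (Fin K), R.card = K - Th - n + 1 ∧ c = (R.biUnion (users H)).card}

/-- The multiple cyclic network: user `i` is connected to the relays
`i, i - 1, …, i - n + 1` modulo `K` (users and relays are numbered from `0`). -/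
def multipleCyclic (N K n : ℕ) (i : Fin N) : Finset (Fin K) :=
  Finset.univ.filter (fun j => ∃ s < n, ((j : ℕ) + s) % K = (i : ℕ) % K)

/-! ### Hierarchical aggregation schemes -/

/-- A two-hop aggregation scheme over the finite field `F` on the network `H`
(without the decodability and security requirements). -/
structure Scheme (F : Type u) [Field F] [Fintype F] {N K : ℕ}
    (H : Fin N → Finset (Fin K)) where
  /-- the underlying discrete probability space -/
  Ω : Type u
  μ : PMF Ω
  /-- number of `F`-symbols of an input, of an individual key, and of the source key -/
  L : ℕ
  LZ : ℕ
  LZS : ℕ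
  L_pos : 0 < L
  /-- alphabets of the first-hop and of the second-hop messages -/
  MX : Type u
  MY : Type u
  [fintypeMX : Fintype MX]
  [fintypeMY : Fintype MY]
  /-- inputs, individual keys, source key -/
  W : Fin N → Ω → (Fin L → F)
  Z : Fin N → Ω → (Fin LZ → F)
  ZS : Ω → (Fin LZS → F)
  /-- messages; only the `X i j` with `j ∈ H i` are sent -/
  X : Fin N → Fin K → Ω → MX
  Y : Fin K → Ω → MY
  /-- the inputs are independent and uniformly distributed -/
  W_uniform : μ.map (fun ω i => W i ω) = PMF.uniformOfFintype (Fin N → Fin L → F)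
  /-- the individual keys are functions of the source key -/
  Z_of_source : condEntropy (Fintype.card F) μ (fun ω i => Z i ω) ZS = 0
  /-- the source key consists of `H(Z_1, …, Z_N)` symbols -/
  source_length : (LZS : ℝ) = entropy (Fintype.card F) μ (fun ω i => Z i ω)
  /-- the keys are independent of the inputs -/
  indep : entropy (Fintype.card F) μ (fun ω => ((fun i => W i ω), (fun i => Z i ω))) =
    ∑ i, entropy (Fintype.card F) μ (W i) + entropy (Fintype.card F) μ (fun ω i => Z i ω)
  /-- first hop: the messages of user `i` are functions of its input and its key -/
  first_hop : ∀ i : Fin N,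
    condEntropy (Fintype.card F) μ (fun ω (j : H i) => X i j ω) (fun ω => (W i ω, Z i ω)) = 0
  /-- second hop: the message of relay `j` is a function of the messages it has received -/
  second_hop : ∀ j : Fin K,
    condEntropy (Fintype.card F) μ (Y j) (fun ω (i : users H j) => X i j ω) = 0

attribute [instance] Scheme.fintypeMX Scheme.fintypeMY

namespace Scheme

variable {F : Type u} [Field F] [Fintype F] {N K : ℕ} {H : Fin N → Finset (Fin K)}

/-- The server can recover the sum of all inputs from the messages of the relays. -/
def Decodable (S : Scheme F H) : Prop :=
  condEntropy (Fintype.card F) S.μ (fun ω => ∑ i, S.W i ω) (fun ω j => S.Y j ω) = 0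

/-- At most `Th` relays and at most `Tu` users together learn nothing about the inputs beyond
what the inputs and keys of these users tell. -/
def Private (S : Scheme F H) (Th Tu : ℕ) : Prop :=
  ∀ (R : Finset (Fin K)) (V : Finset (Fin N)), R.card ≤ Th → V.card ≤ Tu →
    condMutualInfo (Fintype.card F) S.μ
      (fun ω i => S.W i ω)
      (fun ω (j : R) (i : users H j) => S.X i j ω)
      (fun ω (i : V) => (S.W i ω, S.Z i ω)) = 0

/-- `(0, Th, Tu)`-security. -/
def IsSecure (S : Scheme F H) (Th Tu : ℕ) : Prop :=
  S.Decodable ∧ S.Private Th Tu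

/-- User-to-relay communication load: the maximum of `H(X_{i,j}) / L` over all links. -/
def RX (S : Scheme F H) : ℝ :=
  ⨆ e : {e : Fin N × Fin K // e.2 ∈ H e.1},
    entropy (Fintype.card F) S.μ (S.X e.1.1 e.1.2) / S.L

/-- Relay-to-server communication load: the maximum of `H(Y_j) / L` over all relays. -/
def RY (S : Scheme F H) : ℝ :=
  ⨆ j : Fin K, entropy (Fintype.card F) S.μ (S.Y j) / S.L

/-- Individual key rate. -/
def RZ (S : Scheme F H) : ℝ := (S.LZ : ℝ) / S.L

/-- Source key rate. -/
def RZS (S : Scheme F H) : ℝ := (S.LZS : ℝ) / S.L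

end Scheme

end

end HSA

/-!
The proof has an information-theoretic half and a coding half.

**Lower bounds.** Conditions `H(X | Y) = 0` are traded for the pointwise relation `DeterminedBy`,
and all inequalities then follow from one form of submodularity, `entropy_submodular`. Given the
inputs and keys of all the users but `i`, anything from which the server could finish decoding
reveals `W_i`, and hence carries `L` symbols (`Scheme.le_entropy_of_determines`). The messages of
user `i`, and likewise the messages of its `n` relays to the server, are of this kind, which bounds
both communication rates by `1 / n`. If `R_X = 1 / n`, no first-hop message has any slack: each one
has conditional entropy at least `L / n` given the data of the other users
(`Scheme.le_entropy_X`). Privacy makes these messages independent of the inputs, so this entropy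
has to come from the keys: given the keys of at most `T_u` users, the keys of `k` further users of
one relay have entropy at least `k L / n` (`Scheme.le_entropy_keys_union`). Building up a coalition
of `T_u` users one by one, and then adding the `m` users of a relay disjoint from it, gives
`(T_u + m) L / n`.

**Construction.** Over an extension field `E` of `F` with enough elements, put `T = T_u + m`. The
keys are the values of a random polynomial of degree less than `T` at `N` points, scaled by the
weights of the divided difference of order `N - 1`. Any `T` of them are independent, and, because
`T < N`, they sum to zero (`sum_divDiffKey`). User `i` regards its input in `E ^ n` as a linear
functional on polynomials of degree less than `n`, and sends to relay `j` its value at the Lagrange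
basis polynomial `ℓ_j` of the nodes of its `n` relays, masked by its key times `ℓ_j(x₀)`, where `x₀`
is a point outside the nodes. Relays add up what they receive. As `∑ x_j ^ k ℓ_j = X ^ k`, the
server obtains coordinate `k` of the sum of the inputs plus `x₀ ^ k` times the sum of the keys,
which is zero (`sum_pow_mul_relay`). As `ℓ_j(x₀) ≠ 0`, and a relay with a coalition of `T_u` users
meets at most `T` keys, every message outside the coalition is masked by a one-time pad
(`codeScheme_private`).
-/

namespace HSA

/-! ### Entropy as a polymatroid -/

section Entropy

variable {Ω α β γ δ : Type*} [Fintype α] [Fintype β] [Fintype γ] [Fintype δ]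

/-- The real-valued probability of the event `X = a`. -/
noncomputable def prob {Ω α : Type*} (μ : PMF Ω) (X : Ω → α) (a : α) : ℝ :=
  ((μ.map X) a).toReal

/-- `X` is almost surely a function of `Y`: on the support of `μ`, the value of `Y` determines
the value of `X`. -/
def DeterminedBy {Ω α β : Type*} (μ : PMF Ω) (X : Ω → α) (Y : Ω → β) : Prop :=
  ∀ ω ∈ μ.support, ∀ ω' ∈ μ.support, Y ω = Y ω' → X ω = X ω'

lemma prob_nonneg {Ω α : Type*} (μ : PMF Ω) (X : Ω → α) (a : α) : 0 ≤ prob μ X a := ENNReal.toReal_nonneg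

lemma sum_prob (μ : PMF Ω) (X : Ω → α) : ∑ a, prob μ X a = 1 := by
  unfold prob
  rw [← ENNReal.toReal_sum (fun a _ => PMF.apply_ne_top _ a), ← tsum_fintype (L := .unconditional _),
    PMF.tsum_coe, ENNReal.toReal_one]

lemma prob_pos_iff {Ω α : Type*} (μ : PMF Ω) (X : Ω → α) (a : α) :
    0 < prob μ X a ↔ ∃ ω ∈ μ.support, X ω = a := by
  unfold prob
  rw [ENNReal.toReal_pos_iff, ← PMF.mem_support_map_iff, PMF.mem_support_iff, pos_iff_ne_zero,
    and_iff_left (PMF.apply_lt_top _ a)]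

lemma prob_comp {Ω α β : Type*} [Fintype α] [DecidableEq β] (μ : PMF Ω) (X : Ω → α) (f : α → β) (b : β) :
    prob μ (fun ω => f (X ω)) b = ∑ a, if b = f a then prob μ X a else 0 := by
  unfold prob
  have : μ.map (fun ω => f (X ω)) = (μ.map X).map f := by
    rw [PMF.map_comp]; rfl
  rw [this, PMF.map_apply, tsum_fintype, ENNReal.toReal_sum]
  · refine Finset.sum_congr rfl fun a _ => ?_
    split_ifs <;> simp
  · intro a _
    split_ifs
    · exact PMF.apply_ne_top _ a
    · simp

/-- The marginal of a joint distribution. -/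
lemma sum_prob_prod (μ : PMF Ω) (X : Ω → α) (Y : Ω → β) (b : β) :
    ∑ a, prob μ (fun ω => (X ω, Y ω)) (a, b) = prob μ Y b := by
  classical
  rw [prob_comp μ (fun ω => (X ω, Y ω)) Prod.snd b, Fintype.sum_prod_type]
  simp

lemma prob_swap (μ : PMF Ω) (X : Ω → α) (Y : Ω → β) (a : α) (b : β) :
    prob μ (fun ω => (X ω, Y ω)) (a, b) = prob μ (fun ω => (Y ω, X ω)) (b, a) := by
  classical
  have h := prob_comp μ (fun ω => (Y ω, X ω)) Prod.swap (a, b)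
  rw [Fintype.sum_prod_type] at h
  refine h.trans ?_
  simp [Prod.ext_iff, ite_and]

lemma prob_prod_le (μ : PMF Ω) (X : Ω → α) (Y : Ω → β) (a : α) (b : β) :
    prob μ (fun ω => (X ω, Y ω)) (a, b) ≤ prob μ Y b := by
  rw [← sum_prob_prod μ X Y b]
  exact Finset.single_le_sum (f := fun a => prob μ (fun ω => (X ω, Y ω)) (a, b))
    (fun _ _ => prob_nonneg _ _ _) (Finset.mem_univ a)

lemma entropy_eq (q : ℕ) (μ : PMF Ω) (X : Ω → α) :
    entropy q μ X = (∑ a, Real.negMulLog (prob μ X a)) / Real.log q := rfl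

lemma sum_negMulLog_marginal (μ : PMF Ω) (X : Ω → α) (Y : Ω → β) :
    ∑ b, Real.negMulLog (prob μ Y b) = ∑ a, ∑ b,
      -(prob μ (fun ω => (X ω, Y ω)) (a, b) * Real.log (prob μ Y b)) := by
  rw [Finset.sum_comm]
  refine Finset.sum_congr rfl fun b _ => ?_
  rw [Finset.sum_neg_distrib, ← Finset.sum_mul, sum_prob_prod, Real.negMulLog, neg_mul]

lemma condEntropy_eq_sum (q : ℕ) (μ : PMF Ω) (X : Ω → α) (Y : Ω → β) :
    condEntropy q μ X Y = (∑ a, ∑ b, prob μ (fun ω => (X ω, Y ω)) (a, b) *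
      (Real.log (prob μ Y b) - Real.log (prob μ (fun ω => (X ω, Y ω)) (a, b)))) / Real.log q := by
  unfold condEntropy
  rw [entropy_eq, entropy_eq, ← sub_div, sum_negMulLog_marginal μ X Y, Fintype.sum_prod_type,
    ← Finset.sum_sub_distrib]
  congr 1
  refine Finset.sum_congr rfl fun a _ => ?_
  rw [← Finset.sum_sub_distrib]
  refine Finset.sum_congr rfl fun b _ => ?_
  rw [Real.negMulLog]; ring

lemma condEntropy_summand_nonneg (μ : PMF Ω) (X : Ω → α) (Y : Ω → β) (a : α) (b : β) :
    0 ≤ prob μ (fun ω => (X ω, Y ω)) (a, b) *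
      (Real.log (prob μ Y b) - Real.log (prob μ (fun ω => (X ω, Y ω)) (a, b))) := by
  rcases (prob_nonneg μ (fun ω => (X ω, Y ω)) (a, b)).eq_or_lt with h | h
  · rw [← h, zero_mul]
  · exact mul_nonneg h.le (sub_nonneg.2 (Real.log_le_log h (prob_prod_le μ X Y a b)))

lemma condEntropy_nonneg (q : ℕ) (μ : PMF Ω) (X : Ω → α) (Y : Ω → β) :
    0 ≤ condEntropy q μ X Y := by
  rw [condEntropy_eq_sum]
  exact div_nonneg (Finset.sum_nonneg fun a _ => Finset.sum_nonneg fun b _ =>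
    condEntropy_summand_nonneg μ X Y a b) (Real.log_natCast_nonneg q)

lemma DeterminedBy.condEntropy_eq_zero (q : ℕ) {μ : PMF Ω} {X : Ω → α} {Y : Ω → β}
    (h : DeterminedBy μ X Y) : condEntropy q μ X Y = 0 := by
  rw [condEntropy_eq_sum, Finset.sum_eq_zero, zero_div]
  refine fun a _ => Finset.sum_eq_zero fun b _ => ?_
  rcases (prob_nonneg μ (fun ω => (X ω, Y ω)) (a, b)).eq_or_lt with h0 | h0
  · rw [← h0, zero_mul]
  · rw [← sum_prob_prod μ X Y b, Finset.sum_eq_single a, sub_self, mul_zero]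
    · intro a' _ ha'
      by_contra hne
      obtain ⟨ω, hω, e⟩ := (prob_pos_iff _ _ _).1 h0
      obtain ⟨ω', hω', e'⟩ := (prob_pos_iff _ _ _).1 ((prob_nonneg _ _ _).lt_of_ne' hne)
      simp only [Prod.mk.injEq] at e e'
      exact ha' (by rw [← e.1, ← e'.1, h ω hω ω' hω' (e.2.trans e'.2.symm)])
    · simp

lemma determinedBy_of_condEntropy_eq_zero {q : ℕ} (hq : 1 < q) {μ : PMF Ω} {X : Ω → α}
    {Y : Ω → β} (h : condEntropy q μ X Y = 0) : DeterminedBy μ X Y := by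
  have hlog : Real.log q ≠ 0 := (Real.log_pos (by exact_mod_cast hq)).ne'
  rw [condEntropy_eq_sum, div_eq_zero_iff, or_iff_left hlog,
    Finset.sum_eq_zero_iff_of_nonneg fun a _ => Finset.sum_nonneg fun b _ =>
      condEntropy_summand_nonneg μ X Y a b] at h
  intro ω hω ω' hω' hY
  by_contra hX
  have h0 := (prob_pos_iff μ (fun ω => (X ω, Y ω)) (X ω, Y ω)).2 ⟨ω, hω, rfl⟩
  have h1 := (prob_pos_iff μ (fun ω => (X ω, Y ω)) (X ω', Y ω)).2 ⟨ω', hω', by simp [hY]⟩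
  have h2 := (Finset.sum_eq_zero_iff_of_nonneg fun b _ =>
    condEntropy_summand_nonneg μ X Y (X ω) b).1 (h (X ω) (Finset.mem_univ _)) (Y ω)
      (Finset.mem_univ _)
  rw [mul_eq_zero, or_iff_right h0.ne', sub_eq_zero] at h2
  have h3 := Real.log_injOn_pos (h0.trans_le (prob_prod_le μ X Y _ _)) h0 h2
  have h4 := Finset.add_le_sum (f := fun a => prob μ (fun ω => (X ω, Y ω)) (a, Y ω))
    (fun _ _ => prob_nonneg _ _ _) (Finset.mem_univ (X ω)) (Finset.mem_univ (X ω')) hX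
  rw [sum_prob_prod] at h4
  linarith

lemma entropy_swap (q : ℕ) (μ : PMF Ω) (X : Ω → α) (Y : Ω → β) :
    entropy q μ (fun ω => (X ω, Y ω)) = entropy q μ (fun ω => (Y ω, X ω)) := by
  rw [entropy_eq, entropy_eq, Fintype.sum_prod_type, Fintype.sum_prod_type, Finset.sum_comm]
  simp only [prob_swap μ X Y]

lemma DeterminedBy.entropy_le (q : ℕ) {μ : PMF Ω} {X : Ω → α} {Y : Ω → β}
    (h : DeterminedBy μ X Y) : entropy q μ X ≤ entropy q μ Y := by
  have h1 := h.condEntropy_eq_zero q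
  have h2 := condEntropy_nonneg q μ Y X
  unfold condEntropy at h1 h2
  rw [entropy_swap] at h2
  linarith

/-- Submodularity of entropy, i.e. nonnegativity of the conditional mutual information. -/
lemma entropy_submodular_triple (q : ℕ) (μ : PMF Ω) (A : Ω → α) (B : Ω → β) (C : Ω → γ) :
    entropy q μ (fun ω => (A ω, B ω, C ω)) + entropy q μ C ≤
      entropy q μ (fun ω => (A ω, C ω)) + entropy q μ (fun ω => (B ω, C ω)) := by
  set p : α → β → γ → ℝ := fun a b c => prob μ (fun ω => (A ω, B ω, C ω)) (a, b, c)
  set pA : α → γ → ℝ := fun a c => prob μ (fun ω => (A ω, C ω)) (a, c)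
  set pB : β → γ → ℝ := fun b c => prob μ (fun ω => (B ω, C ω)) (b, c)
  set pC : γ → ℝ := fun c => prob μ C c
  have hp : ∀ a b c, 0 ≤ p a b c := fun _ _ _ => prob_nonneg _ _ _
  have hpA : ∀ a c, 0 ≤ pA a c := fun _ _ => prob_nonneg _ _ _
  have hpB : ∀ b c, 0 ≤ pB b c := fun _ _ => prob_nonneg _ _ _
  have hpC : ∀ c, 0 ≤ pC c := fun _ => prob_nonneg _ _ _
  have mA : ∀ a c, ∑ b, p a b c = pA a c := fun a c => by
    classical
    simp only [p, pA]
    rw [prob_comp μ (fun ω => (A ω, B ω, C ω)) (fun x => (x.1, x.2.2)) (a, c),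
      Fintype.sum_prod_type]
    simp [Fintype.sum_prod_type, Prod.ext_iff, ite_and, Finset.sum_ite_irrel]
  have mB : ∀ b c, ∑ a, p a b c = pB b c := fun b c => sum_prob_prod μ A (fun ω => (B ω, C ω)) (b, c)
  have mC : ∀ c, ∑ b, pB b c = pC c := fun c => sum_prob_prod μ B C c
  have mC' : ∀ c, ∑ a, pA a c = pC c := fun c => sum_prob_prod μ A C c
  have eABC : ∑ x, Real.negMulLog (prob μ (fun ω => (A ω, B ω, C ω)) x) =
      ∑ a, ∑ b, ∑ c, -(p a b c * Real.log (p a b c)) := by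
    simp [Fintype.sum_prod_type, Real.negMulLog, p]
  have eA : ∑ x, Real.negMulLog (prob μ (fun ω => (A ω, C ω)) x) =
      ∑ a, ∑ b, ∑ c, -(p a b c * Real.log (pA a c)) := by
    rw [Fintype.sum_prod_type]
    refine Finset.sum_congr rfl fun a _ => ?_
    rw [Finset.sum_comm]
    refine Finset.sum_congr rfl fun c _ => ?_
    rw [Finset.sum_neg_distrib, ← Finset.sum_mul, mA, Real.negMulLog, neg_mul]
  have eB : ∑ x, Real.negMulLog (prob μ (fun ω => (B ω, C ω)) x) =
      ∑ a, ∑ b, ∑ c, -(p a b c * Real.log (pB b c)) := by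
    rw [Fintype.sum_prod_type]
    conv_rhs => rw [Finset.sum_comm]
    refine Finset.sum_congr rfl fun b _ => ?_
    rw [Finset.sum_comm]
    refine Finset.sum_congr rfl fun c _ => ?_
    rw [Finset.sum_neg_distrib, ← Finset.sum_mul, mB, Real.negMulLog, neg_mul]
  have eC : ∑ x, Real.negMulLog (prob μ C x) =
      ∑ a, ∑ b, ∑ c, -(p a b c * Real.log (pC c)) := by
    rw [sum_negMulLog_marginal μ (fun ω => (A ω, B ω)) C, Fintype.sum_prod_type]
    refine Finset.sum_congr rfl fun a _ => Finset.sum_congr rfl fun b _ => ?_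
    refine Finset.sum_congr rfl fun c _ => ?_
    have : prob μ (fun ω => ((A ω, B ω), C ω)) ((a, b), c) = p a b c := by
      classical
      simp only [p]
      rw [prob_comp μ (fun ω => (A ω, B ω, C ω)) (fun x => ((x.1, x.2.1), x.2.2)) ((a, b), c),
        Fintype.sum_prod_type]
      simp [Fintype.sum_prod_type, Prod.ext_iff, ite_and, Finset.sum_ite_irrel]
    rw [this]
  -- `log x ≥ 1 - 1 / x` bounds each summand of the mutual information from below.
  have key : ∀ a b c, p a b c - pA a c * pB b c / pC c ≤ -(p a b c * Real.log (pA a c)) +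
      -(p a b c * Real.log (pB b c)) - (-(p a b c * Real.log (p a b c)) +
      -(p a b c * Real.log (pC c))) := by
    intro a b c
    rcases (hp a b c).eq_or_lt with h | h
    · rw [← h]
      have := div_nonneg (mul_nonneg (hpA a c) (hpB b c)) (hpC c)
      simpa using this
    · have h1 : 0 < pA a c := h.trans_le (mA a c ▸ Finset.single_le_sum
        (f := fun b => p a b c) (fun b _ => hp a b c) (Finset.mem_univ b))
      have h2 : 0 < pB b c := h.trans_le (mB b c ▸ Finset.single_le_sum
        (f := fun a => p a b c) (fun a _ => hp a b c) (Finset.mem_univ a))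
      have h3 : 0 < pC c := h2.trans_le (mC c ▸ Finset.single_le_sum
        (f := fun b => pB b c) (fun b _ => hpB b c) (Finset.mem_univ b))
      have h4 := Real.log_le_sub_one_of_pos (x := pA a c * pB b c / (pC c * p a b c)) (by positivity)
      rw [Real.log_div (by positivity) (by positivity), Real.log_mul h1.ne' h2.ne',
        Real.log_mul h3.ne' h.ne'] at h4
      have h5 := mul_le_mul_of_nonneg_left h4 h.le
      have h6 : p a b c * (pA a c * pB b c / (pC c * p a b c) - 1) =
          pA a c * pB b c / pC c - p a b c := by
        field_simp
      rw [h6] at h5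
      linarith
  have s1 : ∑ a, ∑ b, ∑ c, p a b c = 1 := by
    have := sum_prob μ (fun ω => (A ω, B ω, C ω))
    simpa [Fintype.sum_prod_type] using this
  have s2 : ∑ a, ∑ b, ∑ c, pA a c * pB b c / pC c = 1 := by
    rw [← sum_prob μ C]
    calc ∑ a, ∑ b, ∑ c, pA a c * pB b c / pC c
        = ∑ c, ∑ a, ∑ b, pA a c * pB b c / pC c := by
          simp_rw [Finset.sum_comm (s := (Finset.univ : Finset β))]
          exact Finset.sum_comm
      _ = ∑ c, pC c := by
          refine Finset.sum_congr rfl fun c _ => ?_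
          simp_rw [← Finset.sum_div, ← Finset.mul_sum, mC, ← Finset.sum_mul, mC']
          exact mul_self_div_self _
  rw [entropy_eq, entropy_eq, entropy_eq, entropy_eq, ← add_div, ← add_div]
  refine div_le_div_of_nonneg_right ?_ (Real.log_natCast_nonneg q)
  rw [eABC, eA, eB, eC, ← sub_nonneg]
  simp only [← Finset.sum_add_distrib, ← Finset.sum_sub_distrib]
  calc (0 : ℝ) = ∑ a, ∑ b, ∑ c, (p a b c - pA a c * pB b c / pC c) := by
        simp only [Finset.sum_sub_distrib, s1, s2, sub_self]
    _ ≤ _ := Finset.sum_le_sum fun a _ => Finset.sum_le_sum fun b _ =>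
        Finset.sum_le_sum fun c _ => key a b c

/-- Submodularity of entropy, in the form of a polymatroid inequality: `D` plays the role of the
union of `A` and `B`, and `C` that of a part of their intersection. -/
lemma entropy_submodular (q : ℕ) {μ : PMF Ω} {A : Ω → α} {B : Ω → β} {C : Ω → γ} {D : Ω → δ}
    (hD : DeterminedBy μ D (fun ω => (A ω, B ω)))
    (hA : DeterminedBy μ C A) (hB : DeterminedBy μ C B) :
    entropy q μ D + entropy q μ C ≤ entropy q μ A + entropy q μ B := by
  have h := entropy_submodular_triple q μ A B C
  have h1 : entropy q μ D ≤ entropy q μ (fun ω => (A ω, B ω, C ω)) := by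
    refine DeterminedBy.entropy_le q fun ω hω ω' hω' e => hD ω hω ω' hω' ?_
    simp only [Prod.mk.injEq] at e ⊢
    exact ⟨e.1, e.2.1⟩
  have h2 : entropy q μ (fun ω => (A ω, C ω)) ≤ entropy q μ A :=
    DeterminedBy.entropy_le q fun ω hω ω' hω' e => Prod.ext e (hA ω hω ω' hω' e)
  have h3 : entropy q μ (fun ω => (B ω, C ω)) ≤ entropy q μ B :=
    DeterminedBy.entropy_le q fun ω hω ω' hω' e => Prod.ext e (hB ω hω ω' hω' e)
  linarith

lemma entropy_nonneg (q : ℕ) (μ : PMF Ω) (X : Ω → α) : 0 ≤ entropy q μ X := by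
  have h := condEntropy_nonneg q μ X (fun _ : Ω => ())
  have h1 : entropy q μ (fun ω => (X ω, ())) ≤ entropy q μ X :=
    DeterminedBy.entropy_le q fun ω _ ω' _ e => by simpa using e
  have h2 : entropy q μ (fun _ : Ω => ()) = 0 := by
    have := sum_prob μ (fun _ : Ω => ())
    rw [entropy_eq]
    simp only [Finset.univ_unique, Finset.sum_singleton] at this ⊢
    simp [this]
  unfold condEntropy at h
  linarith

/-- Subadditivity of entropy. -/
lemma entropy_le_add (q : ℕ) {μ : PMF Ω} {A : Ω → α} {B : Ω → β} {D : Ω → δ}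
    (hD : DeterminedBy μ D (fun ω => (A ω, B ω))) :
    entropy q μ D ≤ entropy q μ A + entropy q μ B := by
  have h := entropy_submodular q (C := fun _ : Ω => ()) hD (fun _ _ _ _ _ => rfl)
    (fun _ _ _ _ _ => rfl)
  linarith [entropy_nonneg q μ (fun _ : Ω => ())]

/-- Entropy is at most the logarithm of the size of the alphabet. -/
lemma entropy_le_log_card (q : ℕ) (μ : PMF Ω) (X : Ω → α) :
    entropy q μ X ≤ Real.log (Fintype.card α) / Real.log q := by
  rw [entropy_eq]
  refine div_le_div_of_nonneg_right ?_ (Real.log_natCast_nonneg q)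
  obtain ⟨ω, -⟩ := μ.support_nonempty
  have : Nonempty α := ⟨X ω⟩
  have hc : (0 : ℝ) < Fintype.card α := by exact_mod_cast Fintype.card_pos
  have key : ∀ a, Real.negMulLog (prob μ X a) ≤
      prob μ X a * Real.log (Fintype.card α) + ((Fintype.card α : ℝ)⁻¹ - prob μ X a) := by
    intro a
    rcases (prob_nonneg μ X a).eq_or_lt with h | h
    · rw [← h]; simp
    · have h4 := Real.log_le_sub_one_of_pos (x := (Fintype.card α * prob μ X a)⁻¹) (by positivity)
      rw [Real.log_inv, Real.log_mul hc.ne' h.ne'] at h4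
      have h5 := mul_le_mul_of_nonneg_left h4 h.le
      have h6 : prob μ X a * ((Fintype.card α * prob μ X a)⁻¹ - 1) =
          (Fintype.card α : ℝ)⁻¹ - prob μ X a := by
        field_simp
      rw [h6] at h5
      rw [Real.negMulLog]
      linarith
  refine (Finset.sum_le_sum fun a _ => key a).trans ?_
  rw [Finset.sum_add_distrib, ← Finset.sum_mul, Finset.sum_sub_distrib, sum_prob]
  simp [hc.ne']

/-- An alphabet of `q ^ k` letters carries at most `k` units of entropy. -/
lemma entropy_le_of_card {q : ℕ} (hq : 1 < q) (μ : PMF Ω) (X : Ω → α) {k : ℕ}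
    (h : Fintype.card α = q ^ k) : entropy q μ X ≤ k := by
  have hlog : 0 < Real.log q := Real.log_pos (by exact_mod_cast hq)
  have := entropy_le_log_card q μ X
  rwa [h, Nat.cast_pow, Real.log_pow, mul_div_assoc, div_self hlog.ne', mul_one] at this

lemma entropy_uniform {q : ℕ} (hq : 1 < q) {μ : PMF Ω} [Nonempty α] {X : Ω → α}
    (hX : μ.map X = PMF.uniformOfFintype α) {k : ℕ} (h : Fintype.card α = q ^ k) :
    entropy q μ X = k := by
  have hlog : 0 < Real.log q := Real.log_pos (by exact_mod_cast hq)
  have hq0 : (q : ℝ) ≠ 0 := by positivity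
  unfold entropy
  rw [hX]
  simp only [PMF.uniformOfFintype_apply, h, Finset.sum_const, Finset.card_univ, nsmul_eq_mul,
    Real.negMulLog, ENNReal.toReal_inv, ENNReal.toReal_natCast, Real.log_inv]
  push_cast
  rw [Real.log_pow]
  field_simp

/-- Subadditivity for a finite family. -/
lemma entropy_pi_le_sum (q : ℕ) {μ : PMF Ω} {ι : Type*} [DecidableEq ι] (X : ι → Ω → α)
    (s : Finset ι) : entropy q μ (fun ω (i : s) => X i ω) ≤ ∑ i ∈ s, entropy q μ (X i) := by
  induction s using Finset.induction_on with
  | empty =>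
    simpa using entropy_le_log_card q μ (fun ω (i : (∅ : Finset ι)) => X i ω)
  | insert a s ha ih =>
    rw [Finset.sum_insert ha]
    refine (entropy_le_add q (A := X a) (B := fun ω (i : s) => X i ω) ?_).trans
      (add_le_add_right ih _)
    intro ω _ ω' _ e
    simp only [Prod.mk.injEq, funext_iff, Subtype.forall] at e
    funext ⟨i, hi⟩
    rcases Finset.mem_insert.1 hi with rfl | hi
    · exact e.1
    · exact e.2 i hi

end Entropy

/-! ### Lower bounds for secure schemes -/

namespace Scheme

variable {F : Type u} [Field F] [Fintype F] {N K : ℕ} {H : Fin N → Finset (Fin K)}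

/-- The inputs and keys of the users in `V`. -/
def userData (S : Scheme F H) (V : Finset (Fin N)) (ω : S.Ω) (i : V) :
    (Fin S.L → F) × (Fin S.LZ → F) := (S.W i ω, S.Z i ω)

/-- The keys of the users in `V`. -/
def keys (S : Scheme F H) (V : Finset (Fin N)) (ω : S.Ω) (i : V) : Fin S.LZ → F := S.Z i ω

/-- The messages which the users in `V` send to relay `j`. -/
def sent (S : Scheme F H) (j : Fin K) (V : Finset (Fin N)) (ω : S.Ω) (i : V) : S.MX := S.X i j ω

lemma userData_eq_iff (S : Scheme F H) (V : Finset (Fin N)) (ω ω' : S.Ω) :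
    S.userData V ω = S.userData V ω' ↔ ∀ i ∈ V, S.W i ω = S.W i ω' ∧ S.Z i ω = S.Z i ω' := by
  simp [userData, funext_iff (f := S.userData V ω), Prod.ext_iff]

lemma keys_eq_iff (S : Scheme F H) (V : Finset (Fin N)) (ω ω' : S.Ω) :
    S.keys V ω = S.keys V ω' ↔ ∀ i ∈ V, S.Z i ω = S.Z i ω' := by
  simp [keys, funext_iff (f := S.keys V ω)]

lemma sent_eq_iff (S : Scheme F H) (j : Fin K) (V : Finset (Fin N)) (ω ω' : S.Ω) :
    S.sent j V ω = S.sent j V ω' ↔ ∀ i ∈ V, S.X i j ω = S.X i j ω' := by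
  simp [sent, funext_iff (f := S.sent j V ω)]

lemma mem_users (i : Fin N) (j : Fin K) : i ∈ users H j ↔ j ∈ H i := by simp [users]

lemma X_determinedBy (S : Scheme F H) {i : Fin N} {j : Fin K} (hj : j ∈ H i) :
    DeterminedBy S.μ (S.X i j) (fun ω => (S.W i ω, S.Z i ω)) := by
  intro ω hω ω' hω' e
  have h := determinedBy_of_condEntropy_eq_zero Fintype.one_lt_card (S.first_hop i) ω hω ω' hω' e
  exact congrFun h ⟨j, hj⟩

lemma Y_determinedBy (S : Scheme F H) (j : Fin K) :
    DeterminedBy S.μ (S.Y j) (S.sent j (users H j)) :=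
  determinedBy_of_condEntropy_eq_zero Fintype.one_lt_card (S.second_hop j)

lemma entropy_W_all (S : Scheme F H) :
    entropy (Fintype.card F) S.μ (fun ω i => S.W i ω) = (N : ℝ) * S.L := by
  have h := entropy_uniform (q := Fintype.card F) (k := N * S.L) Fintype.one_lt_card S.W_uniform
    (by simp [← pow_mul, mul_comm])
  rw [h]; push_cast; ring

/-- Since the inputs are uniform and independent of the keys, their entropies add up exactly. -/
lemma entropy_userData_univ (S : Scheme F H) :
    (N : ℝ) * S.L + entropy (Fintype.card F) S.μ (fun ω i => S.Z i ω) ≤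
      entropy (Fintype.card F) S.μ (S.userData Finset.univ) := by
  have h1 : entropy (Fintype.card F) S.μ (fun ω => ((fun i => S.W i ω), (fun i => S.Z i ω))) ≤
      entropy (Fintype.card F) S.μ (S.userData Finset.univ) := by
    refine DeterminedBy.entropy_le _ fun ω _ ω' _ e => ?_
    rw [userData_eq_iff] at e
    ext1 <;> funext i
    · exact (e i (Finset.mem_univ i)).1
    · exact (e i (Finset.mem_univ i)).2
  have h2 : (N : ℝ) * S.L ≤ ∑ i, entropy (Fintype.card F) S.μ (S.W i) := by
    rw [← S.entropy_W_all]
    refine le_trans (DeterminedBy.entropy_le _ fun ω _ ω' _ e => ?_)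
      (entropy_pi_le_sum _ S.W Finset.univ)
    funext i
    exact congrFun e ⟨i, Finset.mem_univ i⟩
  have := S.indep
  linarith

/-- Anything that, together with the data of all the other users, reveals the input of user `i`
carries at least `L` symbols of information given those data. -/
lemma le_entropy_of_determines (S : Scheme F H) (i : Fin N) {β : Type*} [Fintype β] {R : S.Ω → β}
    (hR : DeterminedBy S.μ (S.W i) (fun ω => (R ω, S.userData (Finset.univ.erase i) ω))) :
    S.L + entropy (Fintype.card F) S.μ (S.userData (Finset.univ.erase i)) ≤
      entropy (Fintype.card F) S.μ (fun ω => (R ω, S.userData (Finset.univ.erase i) ω)) := by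
  have h1 := S.entropy_userData_univ
  set Q : S.Ω → (↥(Finset.univ.erase i) → Fin S.L → F) × (Fin N → Fin S.LZ → F) :=
    fun ω => (fun k => S.W k ω, fun k => S.Z k ω) with hQ
  have h2 : entropy (Fintype.card F) S.μ Q ≤ ((N : ℝ) - 1) * S.L +
      entropy (Fintype.card F) S.μ (fun ω i => S.Z i ω) := by
    refine (entropy_le_add _ (A := fun ω (k : ↥(Finset.univ.erase i)) => S.W k ω)
      (B := fun ω i => S.Z i ω) fun ω _ ω' _ e => by simpa [hQ] using e).trans ?_
    gcongr
    refine (entropy_le_of_card (k := (N - 1) * S.L) Fintype.one_lt_card _ _ ?_).trans ?_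
    · simp [← pow_mul, mul_comm]
    · rw [Nat.cast_mul, Nat.cast_sub (Nat.succ_le_of_lt i.pos)]; simp
  have h3 := entropy_submodular (Fintype.card F) (μ := S.μ) (D := S.userData Finset.univ)
    (A := fun ω => (R ω, S.userData (Finset.univ.erase i) ω)) (B := Q)
    (C := S.userData (Finset.univ.erase i)) ?_ ?_ ?_
  · linarith
  · intro ω hω ω' hω' e
    rw [Prod.mk.injEq] at e
    have hW := hR ω hω ω' hω' e.1
    simp only [hQ, Prod.mk.injEq, userData_eq_iff] at e
    rw [userData_eq_iff]
    intro k _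
    refine ⟨?_, congrFun e.2.2 k⟩
    by_cases hk : k = i
    · rw [hk]; exact hW
    · exact (e.1.2 k (by simp [hk])).1
  · intro ω _ ω' _ e
    exact (Prod.mk.inj e).2
  · intro ω _ ω' _ e
    simp only [hQ, Prod.mk.injEq] at e
    rw [userData_eq_iff]
    exact fun k hk => ⟨congrFun e.1 ⟨k, hk⟩, congrFun e.2 k⟩

/-- The second-hop messages of the relays of user `i`, with the data of the other users, reveal the
input of user `i`: the other relays do not hear from user `i`. -/
lemma W_determinedBy_Y (S : Scheme F H) (hS : S.Decodable) (i : Fin N) :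
    DeterminedBy S.μ (S.W i)
      (fun ω => ((fun j : H i => S.Y j ω), S.userData (Finset.univ.erase i) ω)) := by
  intro ω hω ω' hω' e
  simp only [Prod.mk.injEq, userData_eq_iff] at e
  have hY : (fun j => S.Y j ω) = (fun j => S.Y j ω') := by
    funext j
    by_cases hj : j ∈ H i
    · exact congrFun e.1 ⟨j, hj⟩
    · refine S.Y_determinedBy j ω hω ω' hω' ((S.sent_eq_iff _ _ _ _).2 fun k hk => ?_)
      rw [mem_users] at hk
      have hki : k ≠ i := fun h => hj (h ▸ hk)
      have := e.2 k (by simp [hki])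
      exact S.X_determinedBy hk ω hω ω' hω' (Prod.ext this.1 this.2)
  have hsum : ∑ k, S.W k ω = ∑ k, S.W k ω' :=
    determinedBy_of_condEntropy_eq_zero Fintype.one_lt_card hS ω hω ω' hω' hY
  rw [← Finset.add_sum_erase _ _ (Finset.mem_univ i), ← Finset.add_sum_erase _ (fun k => S.W k ω')
    (Finset.mem_univ i), Finset.sum_congr rfl fun k hk => (e.2 k hk).1] at hsum
  exact add_right_cancel hsum

lemma W_determinedBy_X (S : Scheme F H) (hS : S.Decodable) (i : Fin N) :
    DeterminedBy S.μ (S.W i)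
      (fun ω => ((fun j : H i => S.X i j ω), S.userData (Finset.univ.erase i) ω)) := by
  intro ω hω ω' hω' e
  simp only [Prod.mk.injEq, userData_eq_iff] at e
  refine S.W_determinedBy_Y hS i ω hω ω' hω' (Prod.ext ?_ ((S.userData_eq_iff _ _ _).2 e.2))
  funext ⟨j, hj⟩
  refine S.Y_determinedBy j ω hω ω' hω' ((S.sent_eq_iff _ _ _ _).2 fun k hk => ?_)
  rw [mem_users] at hk
  by_cases hki : k = i
  · subst hki; exact congrFun e.1 ⟨j, hk⟩
  · have := e.2 k (by simp [hki])
    exact S.X_determinedBy hk ω hω ω' hω' (Prod.ext this.1 this.2)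

lemma L_le_of_determines (S : Scheme F H) (i : Fin N) {β : Type*} [Fintype β] {R : S.Ω → β}
    (hR : DeterminedBy S.μ (S.W i) (fun ω => (R ω, S.userData (Finset.univ.erase i) ω))) :
    (S.L : ℝ) ≤ entropy (Fintype.card F) S.μ R := by
  have h1 := S.le_entropy_of_determines i hR
  have h2 := entropy_le_add (Fintype.card F) (μ := S.μ) (A := R)
    (B := S.userData (Finset.univ.erase i))
    (D := fun ω => (R ω, S.userData (Finset.univ.erase i) ω)) (fun _ _ _ _ e => e)
  linarith

lemma L_cast_pos (S : Scheme F H) : (0 : ℝ) < S.L := by exact_mod_cast S.L_pos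

lemma entropy_X_le (S : Scheme F H) {i : Fin N} {j : Fin K} (hj : j ∈ H i) :
    entropy (Fintype.card F) S.μ (S.X i j) ≤ S.RX * S.L := by
  rw [← div_le_iff₀ S.L_cast_pos]
  exact le_ciSup (f := fun e : {e : Fin N × Fin K // e.2 ∈ H e.1} =>
    entropy (Fintype.card F) S.μ (S.X e.1.1 e.1.2) / S.L) (Set.finite_range _).bddAbove ⟨(i, j), hj⟩

lemma entropy_Y_le (S : Scheme F H) (j : Fin K) :
    entropy (Fintype.card F) S.μ (S.Y j) ≤ S.RY * S.L := by
  rw [← div_le_iff₀ S.L_cast_pos]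
  exact le_ciSup (f := fun j => entropy (Fintype.card F) S.μ (S.Y j) / S.L)
    (Set.finite_range _).bddAbove j

/-- Cut-set bound on the first hop. -/
theorem one_div_le_RX (S : Scheme F H) (hS : S.Decodable) {n : ℕ} (hn : 0 < n) (i : Fin N)
    (hi : (H i).card = n) : 1 / (n : ℝ) ≤ S.RX := by
  have h1 := S.L_le_of_determines i (S.W_determinedBy_X hS i)
  have h2 := h1.trans (entropy_pi_le_sum (Fintype.card F) (μ := S.μ) (fun j => S.X i j) (H i))
  have h3 := h2.trans (Finset.sum_le_sum fun j hj => S.entropy_X_le hj)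
  rw [Finset.sum_const, hi, nsmul_eq_mul, ← mul_assoc] at h3
  have hL := S.L_cast_pos
  have hn' : (0 : ℝ) < n := by exact_mod_cast hn
  rw [div_le_iff₀ hn', mul_comm]
  exact le_of_mul_le_mul_right (by linarith) hL

/-- Cut-set bound on the second hop. -/
theorem one_div_le_RY (S : Scheme F H) (hS : S.Decodable) {n : ℕ} (hn : 0 < n) (i : Fin N)
    (hi : (H i).card = n) : 1 / (n : ℝ) ≤ S.RY := by
  have h1 := S.L_le_of_determines i (S.W_determinedBy_Y hS i)
  have h2 := h1.trans (entropy_pi_le_sum (Fintype.card F) (μ := S.μ) S.Y (H i))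
  have h3 := h2.trans (Finset.sum_le_sum fun j _ => S.entropy_Y_le j)
  rw [Finset.sum_const, hi, nsmul_eq_mul, ← mul_assoc] at h3
  have hL := S.L_cast_pos
  have hn' : (0 : ℝ) < n := by exact_mod_cast hn
  rw [div_le_iff₀ hn', mul_comm]
  exact le_of_mul_le_mul_right (by linarith) hL

/-- If the first hop is as economical as possible, then every single message is full of
information about its user, even given the data of all the other users. -/
lemma le_entropy_X (S : Scheme F H) (hS : S.Decodable) {n : ℕ} (hn : 0 < n)
    (hH : ∀ i, (H i).card = n) (hRX : S.RX = 1 / (n : ℝ)) {i : Fin N} {j : Fin K} (hj : j ∈ H i) :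
    (S.L : ℝ) / n + entropy (Fintype.card F) S.μ (S.userData (Finset.univ.erase i)) ≤
      entropy (Fintype.card F) S.μ
        (fun ω => (S.X i j ω, S.userData (Finset.univ.erase i) ω)) := by
  have h1 := S.le_entropy_of_determines i (S.W_determinedBy_X hS i)
  have h2 := entropy_le_add (Fintype.card F) (μ := S.μ)
    (A := fun ω => (S.X i j ω, S.userData (Finset.univ.erase i) ω))
    (B := fun ω (k : (H i).erase j) => S.X i k ω)
    (D := fun ω => ((fun j : H i => S.X i j ω), S.userData (Finset.univ.erase i) ω)) ?_
  · have h3 := (entropy_pi_le_sum (Fintype.card F) (μ := S.μ) (fun j => S.X i j)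
      ((H i).erase j)).trans (Finset.sum_le_sum fun k hk =>
        S.entropy_X_le (Finset.mem_of_mem_erase hk))
    have hn' : (0 : ℝ) < n := by exact_mod_cast hn
    rw [Finset.sum_const, Finset.card_erase_of_mem hj, hH, nsmul_eq_mul,
      Nat.cast_sub (Nat.succ_le_of_lt hn), hRX] at h3
    have h4 : ((n : ℝ) - (1 : ℕ)) * (1 / n * S.L) = S.L - S.L / n := by
      push_cast; field_simp
    rw [Nat.succ_eq_add_one, zero_add, h4] at h3
    linarith
  · intro ω _ ω' _ e
    simp only [Prod.mk.injEq] at e ⊢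
    refine ⟨?_, e.1.2⟩
    funext ⟨k, hk⟩
    by_cases hkj : k = j
    · subst hkj; exact e.1.1
    · exact congrFun e.2 ⟨k, Finset.mem_erase.2 ⟨hkj, hk⟩⟩

/-- Messages of different users to one relay carry independent information, even given the data
of further users. -/
lemma le_entropy_sent (S : Scheme F H) (hS : S.Decodable) {n : ℕ} (hn : 0 < n)
    (hH : ∀ i, (H i).card = n) (hRX : S.RX = 1 / (n : ℝ)) (j : Fin K) (V T : Finset (Fin N))
    (hT : T ⊆ users H j) (hTV : Disjoint T V) :
    T.card * ((S.L : ℝ) / n) + entropy (Fintype.card F) S.μ (S.userData V) ≤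
      entropy (Fintype.card F) S.μ (fun ω => (S.sent j T ω, S.userData V ω)) := by
  induction T using Finset.induction_on with
  | empty =>
    simp only [Finset.card_empty, Nat.cast_zero, zero_mul, zero_add]
    exact DeterminedBy.entropy_le _ fun ω _ ω' _ e => (Prod.mk.inj e).2
  | insert s T hs ih =>
    rw [Finset.insert_subset_iff] at hT
    rw [Finset.disjoint_insert_left] at hTV
    have h1 := ih hT.2 hTV.2
    have h2 := S.le_entropy_X hS hn hH hRX ((mem_users s j).1 hT.1)
    have h3 := entropy_submodular (Fintype.card F) (μ := S.μ)
      (A := fun ω => (S.sent j (insert s T) ω, S.userData V ω))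
      (B := S.userData (Finset.univ.erase s))
      (C := fun ω => (S.sent j T ω, S.userData V ω))
      (D := fun ω => (S.X s j ω, S.userData (Finset.univ.erase s) ω)) ?_ ?_ ?_
    · rw [Finset.card_insert_of_notMem hs]
      push_cast
      linarith
    · intro ω _ ω' _ e
      simp only [Prod.mk.injEq, sent_eq_iff] at e ⊢
      exact ⟨e.1.1 s (Finset.mem_insert_self _ _), e.2⟩
    · intro ω _ ω' _ e
      simp only [Prod.mk.injEq, sent_eq_iff] at e ⊢
      exact ⟨fun k hk => e.1 k (Finset.mem_insert_of_mem hk), e.2⟩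
    · intro ω hω ω' hω' e
      simp only [Prod.mk.injEq, sent_eq_iff, userData_eq_iff] at e ⊢
      refine ⟨fun k hk => ?_, fun k hk => e k ?_⟩
      · have := e k (by simpa using fun h : k = s => hs (h ▸ hk))
        exact S.X_determinedBy ((mem_users k j).1 (hT.2 hk)) ω hω ω' hω' (Prod.ext this.1 this.2)
      · simpa using fun h : k = s => hTV.1 (h ▸ hk)

/-- Privacy forces fresh key material: given the keys of an admissible coalition `V`, the keys of
`T` must mask the messages of `T` to a relay. -/
lemma le_entropy_keys_union (S : Scheme F H) {Tu : ℕ} (hS : S.IsSecure 1 Tu) {n : ℕ} (hn : 0 < n)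
    (hH : ∀ i, (H i).card = n) (hRX : S.RX = 1 / (n : ℝ)) (j : Fin K) (V T : Finset (Fin N))
    (hV : V.card ≤ Tu) (hT : T ⊆ users H j) (hTV : Disjoint T V) :
    T.card * ((S.L : ℝ) / n) + entropy (Fintype.card F) S.μ (S.keys V) ≤
      entropy (Fintype.card F) S.μ (S.keys (T ∪ V)) := by
  set W : S.Ω → (Fin N → Fin S.L → F) := fun ω i => S.W i ω
  have h1 := S.le_entropy_sent hS.1 hn hH hRX j V T hT hTV
  have hP := hS.2 {j} V (by simp) hV
  unfold condMutualInfo condEntropy at hP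
  set X : S.Ω → ((r : ({j} : Finset (Fin K))) → users H (r : Fin K) → S.MX) :=
    fun ω r i => S.X i r ω with hX
  have eX : ∀ {ω ω'}, X ω = X ω' ↔ ∀ i ∈ users H j, S.X i j ω = S.X i j ω' := by
    intro ω ω'
    simp [hX, funext_iff]
  have eU : ∀ {ω ω'}, (fun i : V => (S.W i ω, S.Z i ω)) = (fun i : V => (S.W i ω', S.Z i ω')) ↔
    ∀ i ∈ V, S.W i ω = S.W i ω' ∧ S.Z i ω = S.Z i ω' := fun {ω ω'} => S.userData_eq_iff V ω ω'
  -- The whole relay and the coalition learn nothing, hence neither does the part `T` of the relay.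
  have h2 := entropy_submodular (Fintype.card F) (μ := S.μ)
    (A := fun ω => (W ω, S.sent j T ω, S.userData V ω))
    (B := fun ω => (X ω, fun i : V => (S.W i ω, S.Z i ω)))
    (C := fun ω => (S.sent j T ω, S.userData V ω))
    (D := fun ω => (W ω, X ω, fun i : V => (S.W i ω, S.Z i ω))) ?_ ?_ ?_
  · -- The messages of `T` are functions of all the inputs and of the keys of `T`.
    have h3 := entropy_submodular (Fintype.card F) (μ := S.μ)
      (A := fun ω => (W ω, fun i : V => (S.W i ω, S.Z i ω)))
      (B := S.keys (T ∪ V))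
      (C := S.keys V)
      (D := fun ω => (W ω, S.sent j T ω, S.userData V ω)) ?_ ?_ ?_
    · have h4 : entropy (Fintype.card F) S.μ (S.userData V) =
        entropy (Fintype.card F) S.μ (fun ω (i : V) => (S.W i ω, S.Z i ω)) := rfl
      linarith
    · intro ω hω ω' hω' e
      simp only [Prod.mk.injEq, sent_eq_iff, userData_eq_iff, keys_eq_iff, eU] at e ⊢
      refine ⟨e.1.1, fun k hk => ?_, e.1.2⟩
      exact S.X_determinedBy ((mem_users k j).1 (hT hk)) ω hω ω' hω'
        (Prod.ext (congrFun e.1.1 k) (e.2 k (Finset.mem_union_left _ hk)))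
    · intro ω hω ω' hω' e
      simp only [Prod.mk.injEq, keys_eq_iff, eU] at e ⊢
      exact fun k hk => (e.2 k hk).2
    · intro ω hω ω' hω' e
      simp only [keys_eq_iff] at e ⊢
      exact fun k hk => e k (Finset.mem_union_right _ hk)
  · intro ω hω ω' hω' e
    simp only [Prod.mk.injEq] at e ⊢
    exact ⟨e.1.1, e.2⟩
  · intro ω hω ω' hω' e
    simp only [Prod.mk.injEq] at e ⊢
    exact e.2
  · intro ω hω ω' hω' e
    simp only [Prod.mk.injEq, sent_eq_iff, userData_eq_iff, eX, eU] at e ⊢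
    exact ⟨fun k hk => e.1 k (hT hk), e.2⟩

lemma le_entropy_keys (S : Scheme F H) {Tu : ℕ} (hS : S.IsSecure 1 Tu) {n : ℕ} (hn : 0 < n)
    (hH : ∀ i, (H i).card = n) (hRX : S.RX = 1 / (n : ℝ)) (V : Finset (Fin N))
    (hV : V.card ≤ Tu + 1) :
    V.card * ((S.L : ℝ) / n) ≤ entropy (Fintype.card F) S.μ (S.keys V) := by
  induction V using Finset.induction_on with
  | empty => simpa using entropy_nonneg _ _ _
  | insert v V hv ih =>
    rw [Finset.card_insert_of_notMem hv] at hV ⊢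
    obtain ⟨j, hj⟩ : (H v).Nonempty := Finset.card_pos.1 (by rw [hH]; exact hn)
    have h1 := S.le_entropy_keys_union hS hn hH hRX j V {v} (by lia)
      (by simpa using (mem_users v j).2 hj) (by simpa using hv)
    have h2 := ih (by lia)
    rw [Finset.card_singleton, ← Finset.insert_eq] at h1
    push_cast at h1 ⊢
    linarith

theorem one_div_le_RZ (S : Scheme F H) {Tu : ℕ} (hS : S.IsSecure 1 Tu) {n : ℕ} (hn : 0 < n)
    (hH : ∀ i, (H i).card = n) (hRX : S.RX = 1 / (n : ℝ)) (i : Fin N) : 1 / (n : ℝ) ≤ S.RZ := by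
  have h1 := S.le_entropy_keys hS hn hH hRX {i} (by simp)
  have h2 : entropy (Fintype.card F) S.μ (S.keys {i}) ≤ S.LZ :=
    entropy_le_of_card Fintype.one_lt_card _ _ (by simp)
  have hL := S.L_cast_pos
  unfold RZ
  rw [le_div_iff₀ hL]
  simp only [Finset.card_singleton, Nat.cast_one, one_mul] at h1
  calc 1 / (n : ℝ) * S.L = S.L / n := by ring
    _ ≤ _ := h1.trans h2

/-- A relay with `m` users and a disjoint coalition of `Tu` users need `Tu + m` independent
messages' worth of key. -/
theorem le_RZS (S : Scheme F H) {Tu m : ℕ} (hS : S.IsSecure 1 Tu) {n : ℕ} (hn : 0 < n)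
    (hH : ∀ i, (H i).card = n) (hRX : S.RX = 1 / (n : ℝ)) (j : Fin K)
    (hj : (users H j).card = m) (hTu : Tu + m ≤ N) : ((Tu : ℝ) + m) / n ≤ S.RZS := by
  obtain ⟨V, hV, hVc⟩ := Finset.exists_subset_card_eq (s := (users H j)ᶜ) (n := Tu)
    (by rw [Finset.card_compl, hj, Fintype.card_fin]; lia)
  have h1 := S.le_entropy_keys_union hS hn hH hRX j V (users H j) hVc.le subset_rfl
    (Finset.disjoint_left.2 fun k hk hk' => (Finset.mem_compl.1 (hV hk')) hk)
  have h2 := S.le_entropy_keys hS hn hH hRX V (by lia)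
  have h3 : entropy (Fintype.card F) S.μ (S.keys (users H j ∪ V)) ≤ S.LZS := by
    rw [S.source_length]
    refine DeterminedBy.entropy_le _ fun ω _ ω' _ e => ?_
    rw [keys_eq_iff]
    exact fun k _ => congrFun e k
  have hL := S.L_cast_pos
  unfold RZS
  rw [le_div_iff₀ hL]
  rw [hVc] at h2
  rw [hj] at h1
  calc ((Tu : ℝ) + m) / n * S.L = Tu * (S.L / n) + m * (S.L / n) := by ring
    _ ≤ _ := by linarith

end Scheme

/-! ### Schemes from MDS keys -/

section Uniform

lemma map_fst_uniformOfFintype {α β : Type*} [Fintype α] [Fintype β] [Nonempty α] [Nonempty β] :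
    (PMF.uniformOfFintype (α × β)).map Prod.fst = PMF.uniformOfFintype α := by
  classical
  ext a
  rw [PMF.map_apply, tsum_fintype, Fintype.sum_prod_type]
  simp only [PMF.uniformOfFintype_apply, Finset.sum_const, Finset.card_univ,
    nsmul_eq_mul, mul_ite, mul_zero, Finset.sum_ite_eq, Finset.mem_univ, if_true, Fintype.card_prod,
    Nat.cast_mul]
  have hβ : (Fintype.card β : ENNReal) ≠ 0 := by simp
  rw [ENNReal.mul_inv (Or.inr (by simp)) (Or.inr hβ), mul_left_comm,
    ENNReal.mul_inv_cancel hβ (by simp), mul_one]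

/-- On a uniform space of `q ^ k` points, an injective random variable has entropy `k`. -/
lemma le_entropy_of_injective {q : ℕ} (hq : 1 < q) {Ω α : Type*} [Fintype Ω] [Nonempty Ω]
    [Fintype α] {X : Ω → α} (hX : Function.Injective X) {k : ℕ} (h : Fintype.card Ω = q ^ k) :
    (k : ℝ) ≤ entropy q (PMF.uniformOfFintype Ω) X := by
  rw [← entropy_uniform (μ := PMF.uniformOfFintype Ω) (X := id) hq (PMF.map_id _) h]
  exact DeterminedBy.entropy_le q fun ω _ ω' _ e => hX e

end Uniform

section CodeScheme

variable {F : Type u} [Field F] [Fintype F] {N K L l T : ℕ} {H : Fin N → Finset (Fin K)}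

/-- `key` assigns to the users functions of a source key of `T * l` symbols, in such a way that
the keys of any `T` users determine the source key (the MDS property). -/
def IsMDS (key : Fin N → (Fin (T * l) → F) → (Fin l → F)) : Prop :=
  ∀ B : Finset (Fin N), B.card = T → ∀ s s', (∀ i ∈ B, key i s = key i s') → s = s'

/-- Uniformly distributed inputs and source key. -/
noncomputable def codeMeasure (F : Type u) [Field F] [Fintype F] (N L l T : ℕ) :
    PMF ((Fin N → Fin L → F) × (Fin (T * l) → F)) :=
  PMF.uniformOfFintype _

lemma entropy_inputs_le :
    entropy (Fintype.card F) (codeMeasure F N L l T) (fun ω => ω.1) ≤ (N : ℝ) * L := by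
  have h := entropy_le_of_card (α := Fin N → Fin L → F) (k := N * L) (q := Fintype.card F)
    Fintype.one_lt_card (codeMeasure F N L l T) (fun ω => ω.1) (by simp [← pow_mul, mul_comm])
  rwa [Nat.cast_mul] at h

lemma sum_entropy_input_le :
    ∑ i, entropy (Fintype.card F) (codeMeasure F N L l T) (fun ω => ω.1 i) ≤ (N : ℝ) * L := by
  have h : ∀ i, entropy (Fintype.card F) (codeMeasure F N L l T) (fun ω => ω.1 i) ≤ (L : ℝ) :=
    fun i => entropy_le_of_card (α := Fin L → F) Fintype.one_lt_card _ _ (by simp)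
  simpa using Finset.sum_le_sum fun i (_ : i ∈ Finset.univ) => h i

lemma entropy_keys_le (key : Fin N → (Fin (T * l) → F) → (Fin l → F)) :
    entropy (Fintype.card F) (codeMeasure F N L l T) (fun ω i => key i ω.2) ≤ (T : ℝ) * l := by
  have h1 : entropy (Fintype.card F) (codeMeasure F N L l T) (fun ω i => key i ω.2) ≤
      entropy (Fintype.card F) (codeMeasure F N L l T) (fun ω => ω.2) :=
    DeterminedBy.entropy_le _ fun ω _ ω' _ e => congrArg (fun s i => key i s) e
  have h2 := entropy_le_of_card (α := Fin (T * l) → F) (k := T * l) (q := Fintype.card F)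
    Fintype.one_lt_card (codeMeasure F N L l T) (fun ω => ω.2) (by simp)
  rw [Nat.cast_mul] at h2
  exact h1.trans h2

/-- Any at most `T` keys of an MDS family are jointly uniform, and independent of the inputs. -/
lemma IsMDS.le_entropy {key : Fin N → (Fin (T * l) → F) → (Fin l → F)} (hkey : IsMDS key)
    (hT : T ≤ N) (V : Finset (Fin N)) (hV : V.card ≤ T) :
    (N : ℝ) * L + V.card * l ≤ entropy (Fintype.card F) (codeMeasure F N L l T)
      (fun ω => (ω.1, fun i : V => key i ω.2)) := by
  obtain ⟨B, hVB, hB⟩ := Finset.exists_superset_card_eq hV (by simpa using hT)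
  have h1 : ((N * L + T * l : ℕ) : ℝ) ≤ entropy (Fintype.card F) (codeMeasure F N L l T)
      (fun ω => (ω.1, fun i : B => key i ω.2)) := by
    refine le_entropy_of_injective Fintype.one_lt_card (fun ω ω' e => ?_) ?_
    · simp only [Prod.mk.injEq, funext_iff (f := fun i : B => key i ω.2), Subtype.forall] at e
      exact Prod.ext e.1 (hkey B hB _ _ e.2)
    · simp [← pow_mul, pow_add, mul_comm]
  have h2 := entropy_le_add (Fintype.card F) (μ := codeMeasure F N L l T)
    (A := fun ω => (ω.1, fun i : V => key i ω.2))
    (B := fun ω (i : ↥(B \ V)) => key i ω.2) (D := fun ω => (ω.1, fun i : B => key i ω.2)) ?_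
  · have h3 : entropy (Fintype.card F) (codeMeasure F N L l T)
        (fun ω (i : ↥(B \ V)) => key i ω.2) ≤ (((T - V.card) * l : ℕ) : ℝ) := by
      refine entropy_le_of_card Fintype.one_lt_card _ _ ?_
      simp only [Fintype.card_fun, Fintype.card_coe, Fintype.card_fin]
      rw [Finset.card_sdiff_of_subset hVB, hB, ← pow_mul, mul_comm]
    rw [Nat.cast_mul, Nat.cast_sub hV] at h3
    push_cast at h1
    linarith
  · intro ω _ ω' _ e
    simp only [Prod.mk.injEq, funext_iff (f := fun i : V => key i ω.2), Subtype.forall,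
      funext_iff (f := fun i : ↥(B \ V) => key i ω.2)] at e ⊢
    refine ⟨e.1.1, funext fun ⟨i, hi⟩ => ?_⟩
    by_cases hiV : i ∈ V
    · exact e.1.2 i hiV
    · exact e.2 i (Finset.mem_sdiff.2 ⟨hi, hiV⟩)

lemma IsMDS.le_entropy_all {key : Fin N → (Fin (T * l) → F) → (Fin l → F)} (hkey : IsMDS key)
    (hT : T ≤ N) : (N : ℝ) * L + T * l ≤ entropy (Fintype.card F) (codeMeasure F N L l T)
      (fun ω => (ω.1, fun i => key i ω.2)) := by
  obtain ⟨B, -, hB⟩ := Finset.exists_superset_card_eq (s := (∅ : Finset (Fin N))) (n := T)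
    (by simp) (by simpa using hT)
  have h1 := hkey.le_entropy (L := L) hT B hB.le
  rw [hB] at h1
  refine h1.trans (DeterminedBy.entropy_le _ fun ω _ ω' _ e => ?_)
  rw [Prod.mk.injEq] at e ⊢
  exact ⟨e.1, funext fun i => congrFun e.2 i⟩

lemma entropy_inputs_keys_le (key : Fin N → (Fin (T * l) → F) → (Fin l → F)) :
    entropy (Fintype.card F) (codeMeasure F N L l T) (fun ω => (ω.1, fun i => key i ω.2)) ≤
      entropy (Fintype.card F) (codeMeasure F N L l T) (fun ω => ω.1) +
      entropy (Fintype.card F) (codeMeasure F N L l T) (fun ω i => key i ω.2) :=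
  entropy_le_add _ fun _ _ _ _ e => e

lemma entropy_inputs_le_sum :
    entropy (Fintype.card F) (codeMeasure F N L l T) (fun ω => ω.1) ≤
      ∑ i, entropy (Fintype.card F) (codeMeasure F N L l T) (fun ω => ω.1 i) :=
  (DeterminedBy.entropy_le _ fun _ _ _ _ e => funext fun i =>
    congrFun e ⟨i, Finset.mem_univ i⟩).trans
    (entropy_pi_le_sum _ (fun i (ω : (Fin N → Fin L → F) × (Fin (T * l) → F)) => ω.1 i) Finset.univ)

lemma IsMDS.entropy_keys {key : Fin N → (Fin (T * l) → F) → (Fin l → F)} (hkey : IsMDS key)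
    (hT : T ≤ N) : entropy (Fintype.card F) (codeMeasure F N L l T) (fun ω i => key i ω.2) =
      (T : ℝ) * l := by
  have h1 := hkey.le_entropy_all (L := L) hT
  have h2 := entropy_inputs_keys_le (L := L) key
  have h3 := entropy_inputs_le (F := F) (N := N) (L := L) (l := l) (T := T)
  exact le_antisymm (entropy_keys_le key) (by linarith)

/-- The aggregation scheme with uniform inputs and source key, keys `key i` and first-hop messages
`msg i j w z` (for the input `w` and the key `z` of user `i`), in which every relay forwards the
sum of the messages it receives. -/
noncomputable def codeScheme (H : Fin N → Finset (Fin K)) (hL : 0 < L) (hT : T ≤ N)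
    (key : Fin N → (Fin (T * l) → F) → (Fin l → F)) (hkey : IsMDS key)
    (msg : Fin N → Fin K → (Fin L → F) → (Fin l → F) → (Fin l → F)) : Scheme F H where
  Ω := (Fin N → Fin L → F) × (Fin (T * l) → F)
  μ := codeMeasure F N L l T
  L := L
  LZ := l
  LZS := T * l
  L_pos := hL
  MX := Fin l → F
  MY := Fin l → F
  W i ω := ω.1 i
  Z i ω := key i ω.2
  ZS ω := ω.2
  X i j ω := msg i j (ω.1 i) (key i ω.2)
  Y j ω := ∑ i ∈ users H j, msg i j (ω.1 i) (key i ω.2)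
  W_uniform := map_fst_uniformOfFintype
  Z_of_source := DeterminedBy.condEntropy_eq_zero _ fun _ _ _ _ e =>
    congrArg (fun s i => key i s) e
  source_length := by rw [Nat.cast_mul, hkey.entropy_keys hT]
  indep := by
    have h1 := hkey.le_entropy_all (L := L) hT
    have h2 := entropy_inputs_keys_le (L := L) key
    have h3 := entropy_inputs_le_sum (F := F) (N := N) (L := L) (l := l) (T := T)
    have h4 := sum_entropy_input_le (F := F) (N := N) (L := L) (l := l) (T := T)
    have h5 := entropy_keys_le (L := L) key
    exact le_antisymm (h2.trans (by linarith)) (le_trans (by linarith) h1)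
  first_hop i := DeterminedBy.condEntropy_eq_zero _ fun _ _ _ _ e =>
    congrArg (fun (x : (Fin L → F) × (Fin l → F)) (j : H i) => msg i j x.1 x.2) e
  second_hop j := DeterminedBy.condEntropy_eq_zero _ fun ω _ ω' _ e =>
    Finset.sum_congr rfl fun i hi => congrFun e ⟨i, hi⟩

variable (hL : 0 < L) (hT : T ≤ N)
  {key : Fin N → (Fin (T * l) → F) → (Fin l → F)} (hkey : IsMDS key)
  {msg : Fin N → Fin K → (Fin L → F) → (Fin l → F) → (Fin l → F)}

lemma codeScheme_decodable (hdec : ∀ (w w' : Fin N → Fin L → F) (s s' : Fin (T * l) → F),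
      (∀ j, ∑ i ∈ users H j, msg i j (w i) (key i s) = ∑ i ∈ users H j, msg i j (w' i) (key i s')) →
      ∑ i, w i = ∑ i, w' i) :
    (codeScheme H hL hT key hkey msg).Decodable :=
  DeterminedBy.condEntropy_eq_zero _ fun ω _ ω' _ e =>
    hdec ω.1 ω'.1 ω.2 ω'.2 fun j => congrFun e j

/-- One-time-pad argument: the keys of the users heard by a relay and of the coalition are jointly
uniform, so that the messages outside the coalition are masked perfectly. -/
lemma codeScheme_private {Tu m : ℕ} (hTu : Tu + m ≤ T) (hm : ∀ j, (users H j).card ≤ m)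
    (hmsg : ∀ i, ∀ j ∈ H i, ∀ w, Function.Injective (msg i j w)) :
    (codeScheme H hL hT key hkey msg).Private 1 Tu := by
  intro R V hR hV
  set S := codeScheme H hL hT key hkey msg
  set U := R.biUnion (users H) \ V with hU
  have hUV : Disjoint U V := Finset.sdiff_disjoint
  have hUm : U.card ≤ m := by
    refine (Finset.card_le_card Finset.sdiff_subset).trans ?_
    refine (Finset.card_biUnion_le_card_mul R _ m fun j _ => hm j).trans ?_
    exact (Nat.mul_le_mul_right m hR).trans (one_mul m).le
  have h1 := hkey.le_entropy (L := L) hT (U ∪ V) (by rw [Finset.card_union_of_disjoint hUV]; lia)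
  rw [Finset.card_union_of_disjoint hUV] at h1
  set X := fun ω (j : R) (i : users H j) => S.X i j ω with hX
  set A := fun ω (i : V) => (S.W i ω, S.Z i ω) with hA
  set W := fun ω i => S.W i ω with hW
  have eA : ∀ {ω ω'}, A ω = A ω' ↔ ∀ i ∈ V, S.W i ω = S.W i ω' ∧ S.Z i ω = S.Z i ω' :=
    fun {ω ω'} => S.userData_eq_iff V ω ω'
  have eX : ∀ {ω ω'}, X ω = X ω' ↔ ∀ j ∈ R, ∀ i, j ∈ H i → S.X i j ω = S.X i j ω' := by
    intro ω ω'
    simp [hX, funext_iff, Scheme.mem_users]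
  have hUmem : ∀ {i}, i ∈ U ↔ (∃ j ∈ R, j ∈ H i) ∧ i ∉ V := by
    intro i
    simp [hU, Scheme.mem_users]
  -- The messages, with all the inputs, reveal the keys.
  have h2 : entropy (Fintype.card F) S.μ (fun ω => (ω.1, fun i : ↥(U ∪ V) => key i ω.2)) ≤
      entropy (Fintype.card F) S.μ (fun ω => (W ω, X ω, A ω)) := by
    refine DeterminedBy.entropy_le _ fun ω _ ω' _ e => ?_
    simp only [Prod.mk.injEq, eX, eA] at e ⊢
    refine ⟨e.1, funext fun ⟨i, hi⟩ => ?_⟩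
    rcases Finset.mem_union.1 hi with hi | hi
    · obtain ⟨⟨j, hjR, hji⟩, -⟩ := hUmem.1 hi
      have h := e.2.1 j hjR i hji
      have hw : ω.1 i = ω'.1 i := congrFun e.1 i
      refine hmsg i j hji (ω.1 i) (h.trans ?_)
      change msg i j (ω'.1 i) _ = _
      rw [hw]
    · exact (e.2.2 i hi).2
  have h3 : entropy (Fintype.card F) S.μ (fun ω => (W ω, A ω)) ≤ ((N * L + V.card * l : ℕ) : ℝ) := by
    refine (DeterminedBy.entropy_le _ (Y := fun ω => (W ω, S.keys V ω)) fun ω _ ω' _ e => ?_).trans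
      (entropy_le_of_card Fintype.one_lt_card _ _ ?_)
    · simp only [Prod.mk.injEq, eA, Scheme.keys_eq_iff] at e ⊢
      exact ⟨e.1, fun i hi => ⟨congrFun e.1 i, e.2 i hi⟩⟩
    · simp only [Fintype.card_prod, Fintype.card_fun, Fintype.card_fin, Fintype.card_coe]
      rw [← pow_mul, ← pow_mul, pow_add, mul_comm N, mul_comm V.card]
      rfl
  -- The messages of users in the coalition are functions of the data of the coalition.
  have h4 : entropy (Fintype.card F) S.μ (fun ω => (X ω, A ω)) ≤
      ((U.card * l : ℕ) : ℝ) + entropy (Fintype.card F) S.μ A := by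
    choose f hfR hfH using fun i : U => (hUmem.1 i.2).1
    refine (entropy_le_add _ (A := fun ω (i : U) => S.X i (f i) ω) (B := A)
      fun ω hω ω' hω' e => ?_).trans
        (add_le_add_left (entropy_le_of_card Fintype.one_lt_card _ _ ?_) _)
    · simp only [Prod.mk.injEq, eX, eA] at e ⊢
      refine ⟨fun j hj i hji => ?_, e.2⟩
      by_cases hi : i ∈ V
      · exact S.X_determinedBy hji ω hω ω' hω' (Prod.ext (e.2 i hi).1 (e.2 i hi).2)
      · have hiU : i ∈ U := hUmem.2 ⟨⟨j, hj, hji⟩, hi⟩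
        have h := congrFun e.1 ⟨i, hiU⟩
        rwa [Finset.card_le_one.1 hR _ (hfR ⟨i, hiU⟩) j hj] at h
    · simp only [Fintype.card_fun, Fintype.card_coe]
      rw [mul_comm, pow_mul]
      change Fintype.card (Fin l → F) ^ _ = _
      simp
  have h5 := entropy_submodular (Fintype.card F) (μ := S.μ) (A := fun ω => (W ω, A ω))
    (B := fun ω => (X ω, A ω)) (C := A) (D := fun ω => (W ω, X ω, A ω)) ?_ ?_ ?_
  · have h6 : entropy (Fintype.card F) S.μ (fun ω => (ω.1, fun i : ↥(U ∪ V) => key i ω.2)) =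
      entropy (Fintype.card F) (codeMeasure F N L l T)
        (fun ω => (ω.1, fun i : ↥(U ∪ V) => key i ω.2)) := rfl
    unfold condMutualInfo condEntropy
    push_cast at h1 h3 h4
    apply le_antisymm <;> linarith
  · intro ω _ ω' _ e
    simp only [Prod.mk.injEq] at e ⊢
    exact ⟨e.1.1, e.2⟩
  · intro ω _ ω' _ e
    exact (Prod.mk.inj e).2
  · intro ω _ ω' _ e
    exact (Prod.mk.inj e).2

lemma codeScheme_RX_le [Nonempty {e : Fin N × Fin K // e.2 ∈ H e.1}] :
    (codeScheme H hL hT key hkey msg).RX ≤ (l : ℝ) / L :=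
  ciSup_le fun _ => div_le_div_of_nonneg_right
    (entropy_le_of_card Fintype.one_lt_card _ _ (show Fintype.card (Fin l → F) = _ by simp))
    (Nat.cast_nonneg _)

lemma codeScheme_RY_le [Nonempty (Fin K)] :
    (codeScheme H hL hT key hkey msg).RY ≤ (l : ℝ) / L :=
  ciSup_le fun _ => div_le_div_of_nonneg_right
    (entropy_le_of_card Fintype.one_lt_card _ _ (show Fintype.card (Fin l → F) = _ by simp))
    (Nat.cast_nonneg _)

end CodeScheme

/-! ### Degrees in the cyclic network -/

section Network

/-- Membership in the cyclic network without reference to a shift. -/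
lemma exists_shift_iff {K n j r : ℕ} (hnK : n < K) (hj : j < K) (hr : r < K) :
    (∃ s < n, (j + s) % K = r) ↔ (if j ≤ r then r - j else r + K - j) < n := by
  constructor
  · rintro ⟨s, hs, rfl⟩
    rcases lt_or_ge (j + s) K with h | h
    · rw [Nat.mod_eq_of_lt h]; split_ifs <;> lia
    · rw [Nat.mod_eq_sub_mod h, Nat.mod_eq_of_lt (by lia)]; split_ifs <;> lia
  · intro h
    split_ifs at h with hjr
    · exact ⟨_, h, by rw [Nat.add_sub_cancel' hjr, Nat.mod_eq_of_lt hr]⟩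
    · refine ⟨_, h, ?_⟩
      rw [show j + (r + K - j) = r + K by lia, Nat.add_mod_right, Nat.mod_eq_of_lt hr]

lemma shift_injective {K j a b : ℕ} (hj : j < K) (ha : a < K) (hb : b < K)
    (e : (if j ≤ a then a - j else a + K - j) = if j ≤ b then b - j else b + K - j) : a = b := by
  split_ifs at e <;> lia

lemma card_multipleCyclic {N K n : ℕ} (hnK : n < K) (i : Fin N) :
    (multipleCyclic N K n i).card = n := by
  have hr : (i : ℕ) % K < K := Nat.mod_lt _ (by lia)
  obtain ⟨r, hr'⟩ : ∃ r, (i : ℕ) % K = r := ⟨_, rfl⟩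
  rw [hr'] at hr
  have hmem : ∀ j, j ∈ multipleCyclic N K n i ↔
      (if (j : ℕ) ≤ r then r - j else r + K - j) < n := fun j => by
    simp only [multipleCyclic, Finset.mem_filter, Finset.mem_univ, true_and, hr']
    exact exists_shift_iff hnK j.isLt hr
  clear hr'
  conv_rhs => rw [← Finset.card_range n]
  refine Finset.card_bij (fun j _ => if (j : ℕ) ≤ r then r - j else r + K - j) (fun j hj => ?_)
    (fun j hj j' hj' e => ?_) (fun s hs => ?_)
  · exact Finset.mem_range.2 ((hmem j).1 hj)
  · have := j.isLt
    have := j'.isLt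
    ext
    split_ifs at e <;> lia
  · rw [Finset.mem_range] at hs
    refine ⟨⟨if s ≤ r then r - s else r + K - s, by split_ifs <;> lia⟩, (hmem _).2 ?_, ?_⟩ <;>
    · simp only
      split_ifs <;> lia

lemma card_users_multipleCyclic {N K n p : ℕ} (hnK : n < K) (hN : N = K * p) (j : Fin K) :
    (users (multipleCyclic N K n) j).card = p * n := by
  have hK : 0 < K := by lia
  have hj := j.isLt
  have hmem : ∀ i, i ∈ users (multipleCyclic N K n) j ↔
      (if (j : ℕ) ≤ i % K then i % K - j else i % K + K - j) < n := fun i => by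
    simp only [users, multipleCyclic, Finset.mem_filter, Finset.mem_univ, true_and]
    exact exists_shift_iff hnK hj (Nat.mod_lt _ hK)
  have hc : (Finset.range p ×ˢ Finset.range n).card = p * n := by simp
  rw [← hc]
  refine Finset.card_bij
    (fun i _ => ((i : ℕ) / K, if (j : ℕ) ≤ i % K then i % K - j else i % K + K - j))
    (fun i hi => ?_) (fun i hi i' hi' e => ?_) (fun s hs => ?_)
  · rw [Finset.mem_product, Finset.mem_range, Finset.mem_range]
    exact ⟨Nat.div_lt_of_lt_mul (hN ▸ i.isLt), (hmem i).1 hi⟩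
  · rw [Prod.mk.injEq] at e
    have h3 := shift_injective hj (Nat.mod_lt i hK) (Nat.mod_lt i' hK) e.2
    ext
    rw [← Nat.div_add_mod i K, ← Nat.div_add_mod i' K, e.1, h3]
  · obtain ⟨t, s⟩ := s
    rw [Finset.mem_product, Finset.mem_range, Finset.mem_range] at hs
    obtain ⟨ht, hs⟩ := hs
    simp only at ht hs
    set r := if (j : ℕ) + s < K then (j : ℕ) + s else j + s - K with hr
    have hrK : r < K := by rw [hr]; split_ifs <;> lia
    have hlt : K * t + r < N := by
      rw [hN]
      calc K * t + r < K * t + K := by lia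
        _ = K * (t + 1) := by ring
        _ ≤ K * p := Nat.mul_le_mul_left K ht
    have hmod : (K * t + r) % K = r := by rw [Nat.mul_add_mod, Nat.mod_eq_of_lt hrK]
    have hdiv : (K * t + r) / K = t := by
      rw [Nat.mul_add_div hK, Nat.div_eq_of_lt hrK, add_zero]
    have hs' : (if (j : ℕ) ≤ r then r - j else r + K - j) = s := by
      rw [hr]; split_ifs <;> lia
    refine ⟨⟨K * t + r, hlt⟩, (hmem _).2 ?_, ?_⟩
    · simp only [hmod, hs']; exact hs
    · simp only [hmod, hdiv, hs']

end Network

/-! ### Linear codes from interpolation -/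

section Codes

open Polynomial

variable {E : Type*} [Field E]

/-- The key of user `i`: the evaluation at `y i` of the polynomial whose coefficients are the
source key, scaled by the weight that the divided difference of order `N - 1` gives to `y i`. -/
noncomputable def divDiffKey {N T : ℕ} [DecidableEq E] (y : Fin N → E) (i : Fin N)
    (c : Fin T → E) : E :=
  (∏ j ∈ Finset.univ.erase i, (y i - y j))⁻¹ * (Polynomial.ofFn T c).eval (y i)

/-- The divided difference of order `N - 1` kills polynomials of degree less than `N - 1`. -/
lemma sum_divDiffKey [DecidableEq E] {N T : ℕ} {y : Fin N → E} (hy : Function.Injective y)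
    (hT : T + 1 ≤ N) (c : Fin T → E) : ∑ i, divDiffKey y i c = 0 := by
  have hdeg := Polynomial.ofFn_degree_lt c
  have h := Lagrange.coeff_eq_sum (s := Finset.univ) (v := y) hy.injOn (P := Polynomial.ofFn T c)
    (hdeg.trans (by rw [Finset.card_univ, Fintype.card_fin]; exact_mod_cast hT))
  rw [Polynomial.coeff_eq_zero_of_degree_lt] at h
  · rw [h]
    exact Finset.sum_congr rfl fun i _ => by rw [divDiffKey, div_eq_inv_mul]
  · refine hdeg.trans_le ?_
    rw [Finset.card_univ, Fintype.card_fin]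
    exact_mod_cast Nat.le_sub_one_of_lt hT

/-- Any `T` values determine a polynomial of degree less than `T`. -/
lemma divDiffKey_injective [DecidableEq E] {N T : ℕ} {y : Fin N → E} (hy : Function.Injective y)
    {B : Finset (Fin N)} (hB : B.card = T) {c c' : Fin T → E}
    (h : ∀ i ∈ B, divDiffKey y i c = divDiffKey y i c') : c = c' := by
  have := Polynomial.eq_of_degrees_lt_of_eval_index_eq (f := Polynomial.ofFn T c)
    (g := Polynomial.ofFn T c') B hy.injOn (hB ▸ Polynomial.ofFn_degree_lt c)
    (hB ▸ Polynomial.ofFn_degree_lt c') fun i hi => by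
      refine mul_left_cancel₀ (inv_ne_zero (Finset.prod_ne_zero_iff.2 fun j hj => ?_)) (h i hi)
      exact sub_ne_zero.2 fun e => Finset.ne_of_mem_erase hj (hy e.symm)
  funext t
  have h2 := congrArg (fun p => Polynomial.coeff p t) this
  simpa using h2

/-- Lagrange interpolation reproduces the monomials of degree less than the number of nodes. -/
lemma sum_pow_mul_basis {ι : Type*} [DecidableEq ι] {s : Finset ι} {x : ι → E}
    (hx : Function.Injective x) {k : ℕ} (hk : k < s.card) :
    ∑ j ∈ s, C (x j ^ k) * Lagrange.basis s x j = X ^ k := by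
  have h := Lagrange.eq_interpolate (s := s) (v := x) (f := X ^ k) hx.injOn
    (by rw [degree_X_pow]; exact_mod_cast hk)
  rw [Lagrange.interpolate_apply] at h
  simpa using h.symm

lemma sum_pow_mul_coeff_basis {ι : Type*} [DecidableEq ι] {s : Finset ι} {x : ι → E}
    (hx : Function.Injective x) {k : ℕ} (hk : k < s.card) (t : ℕ) :
    ∑ j ∈ s, x j ^ k * (Lagrange.basis s x j).coeff t = if t = k then 1 else 0 := by
  rw [← coeff_X_pow, ← sum_pow_mul_basis hx hk, finsetSum_coeff]
  simp only [coeff_C_mul]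

lemma sum_pow_mul_eval_basis {ι : Type*} [DecidableEq ι] {s : Finset ι} {x : ι → E}
    (hx : Function.Injective x) {k : ℕ} (hk : k < s.card) (x₀ : E) :
    ∑ j ∈ s, x j ^ k * (Lagrange.basis s x j).eval x₀ = x₀ ^ k := by
  have h := congrArg (eval x₀) (sum_pow_mul_basis hx hk)
  rw [eval_finsetSum, eval_pow, eval_X] at h
  simpa using h

lemma eval_basis_ne_zero {ι : Type*} [DecidableEq ι] {s : Finset ι} {x : ι → E}
    (hx : Function.Injective x) {x₀ : E} (hx₀ : ∀ j, x j ≠ x₀) {j : ι} (hj : j ∈ s) :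
    (Lagrange.basis s x j).eval x₀ ≠ 0 := by
  rw [Lagrange.eval_basis_not_at_node hj (hx₀ j).symm, Lagrange.eval_nodal]
  refine mul_ne_zero (Finset.prod_ne_zero_iff.2 fun k _ => sub_ne_zero.2 (hx₀ k).symm)
    (mul_ne_zero (Lagrange.nodalWeight_ne_zero hx.injOn hj)
      (inv_ne_zero (sub_ne_zero.2 (hx₀ j).symm)))

/-- The message of a user with relays `s` to the relay `j`. The input `w` is viewed as the linear
functional on polynomials that sends the monomial of degree `t` to `w t`; it is applied to the
Lagrange basis polynomial of the node `x j`, and the key is added with the value of this polynomial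
at the further point `x₀`. -/
noncomputable def lagrangeMsg {K n : ℕ} (x : Fin K → E) (x₀ : E) (s : Finset (Fin K)) (j : Fin K)
    (w : Fin n → E) (z : E) : E :=
  ∑ t : Fin n, (Lagrange.basis s x j).coeff t * w t + (Lagrange.basis s x j).eval x₀ * z

lemma sum_pow_mul_lagrangeMsg {K n : ℕ} {x : Fin K → E} (hx : Function.Injective x) (x₀ : E)
    {s : Finset (Fin K)} (hs : s.card = n) (w : Fin n → E) (z : E) (k : Fin n) :
    ∑ j ∈ s, x j ^ (k : ℕ) * lagrangeMsg x x₀ s j w z = w k + x₀ ^ (k : ℕ) * z := by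
  have hk : (k : ℕ) < s.card := hs ▸ k.isLt
  simp only [lagrangeMsg, mul_add, Finset.sum_add_distrib, Finset.mul_sum, ← mul_assoc]
  rw [Finset.sum_comm, ← Finset.sum_mul, sum_pow_mul_eval_basis hx hk]
  simp only [← Finset.sum_mul, sum_pow_mul_coeff_basis hx hk, Fin.val_inj]
  simp

end Codes

/-- The interpolation codes need many evaluation points, which a finite extension provides. -/
lemma exists_extension_card_ge (F : Type u) [Field F] [Fintype F] (M : ℕ) :
    ∃ (E : Type) (_ : Field E) (_ : Algebra F E) (_ : Fintype E), M ≤ Fintype.card E := by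
  obtain ⟨p, hp⟩ := CharP.exists F
  have : Fact p.Prime := ⟨CharP.char_is_prime F p⟩
  have hfin := Fintype.ofFinite (FiniteField.Extension F p (M + 1))
  refine ⟨FiniteField.Extension F p (M + 1), inferInstance, inferInstance, hfin, ?_⟩
  rw [Fintype.card_eq_nat_card, FiniteField.natCard_extension]
  exact (Nat.lt_pow_self (Finite.one_lt_card)).le.trans
    (Nat.pow_le_pow_right Nat.card_pos (Nat.le_succ M))

/-! ### Optimal schemes -/

/-- The server can combine the relay sums linearly to the sum of the inputs: the inputs are
reassembled by the interpolation identities, and the keys contribute a multiple of their sum,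
which is zero. -/
lemma sum_pow_mul_relay {E : Type*} [Field E] [DecidableEq E] {N K n T : ℕ}
    {H : Fin N → Finset (Fin K)} (hH : ∀ i, (H i).card = n) {x : Fin K → E}
    (hx : Function.Injective x) (x₀ : E) {y : Fin N → E} (hy : Function.Injective y)
    (hT : T + 1 ≤ N) (w : Fin N → Fin n → E) (c : Fin T → E) (k : Fin n) :
    ∑ j, x j ^ (k : ℕ) * ∑ i ∈ users H j, lagrangeMsg x x₀ (H i) j (w i) (divDiffKey y i c) =
      ∑ i, w i k := by
  simp_rw [Finset.mul_sum]
  rw [Finset.sum_comm' (t' := Finset.univ) (s' := H) (by simp [Scheme.mem_users])]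
  simp_rw [sum_pow_mul_lagrangeMsg hx x₀ (hH _)]
  rw [Finset.sum_add_distrib, ← Finset.mul_sum, sum_divDiffKey hy hT, mul_zero, add_zero]

/-- On every network in which each user has `n` relays and each relay at most `m` users, the rates
`1 / n`, `1 / n`, `1 / n` and `(Tu + m) / n` suffice for `(0, 1, Tu)`-security. -/
theorem exists_secure_scheme (F : Type u) [Field F] [Fintype F] {N K n m Tu : ℕ}
    {H : Fin N → Finset (Fin K)} (hn : 0 < n) (hN : 0 < N) (hH : ∀ i, (H i).card = n)
    (hU : ∀ j, (users H j).card ≤ m) (hT : Tu + m + 1 ≤ N) :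
    ∃ S : Scheme F H, S.IsSecure 1 Tu ∧ S.RX ≤ 1 / (n : ℝ) ∧ S.RY ≤ 1 / (n : ℝ) ∧
      S.RZ = 1 / (n : ℝ) ∧ S.RZS = ((Tu : ℝ) + m) / n := by
  classical
  obtain ⟨E, _, _, _, hE⟩ := exists_extension_card_ge F (max N (K + 1))
  obtain ⟨y⟩ : Nonempty (Fin N ↪ E) :=
    Function.Embedding.nonempty_of_card_le (by simpa using (le_max_left _ _).trans hE)
  obtain ⟨φ⟩ : Nonempty (Fin (K + 1) ↪ E) :=
    Function.Embedding.nonempty_of_card_le (by simpa using (le_max_right _ _).trans hE)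
  set x : Fin K → E := fun j => φ j.castSucc with hx_def
  set x₀ : E := φ (Fin.last K) with hx₀_def
  have hx : Function.Injective x := fun j j' h => Fin.castSucc_injective K (φ.injective h)
  have hx₀ : ∀ j, x j ≠ x₀ := fun j h => (Fin.castSucc_lt_last j).ne (φ.injective h)
  have hfin : Module.Finite F E := Module.Finite.of_finite
  set l := Module.finrank F E with hl
  have hlpos : 0 < l := Module.finrank_pos
  set T := Tu + m with hT_def
  let e : E ≃ₗ[F] (Fin l → F) := LinearEquiv.ofFinrankEq _ _ (by simp [hl])
  let f : (Fin (n * l) → F) ≃ₗ[F] (Fin n → E) :=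
    LinearEquiv.ofFinrankEq _ _ (by simp [hl, Module.finrank_pi_fintype])
  let g : (Fin (T * l) → F) ≃ₗ[F] (Fin T → E) :=
    LinearEquiv.ofFinrankEq _ _ (by simp [hl, Module.finrank_pi_fintype])
  have hL : 0 < n * l := Nat.mul_pos hn hlpos
  let key : Fin N → (Fin (T * l) → F) → (Fin l → F) := fun i s => e (divDiffKey y i (g s))
  let msg : Fin N → Fin K → (Fin (n * l) → F) → (Fin l → F) → (Fin l → F) :=
    fun i j w z => e (lagrangeMsg x x₀ (H i) j (f w) (e.symm z))
  have hkey : IsMDS key := fun B hB s s' h =>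
    g.injective (divDiffKey_injective y.injective hB fun i hi => e.injective (h i hi))
  have hmsg : ∀ i, ∀ j ∈ H i, ∀ w, Function.Injective (msg i j w) := by
    intro i j hj w z z' h
    have h1 := e.injective h
    unfold lagrangeMsg at h1
    exact e.symm.injective
      (mul_left_cancel₀ (eval_basis_ne_zero hx hx₀ hj) (add_left_cancel h1))
  have hrelay : ∀ (w : Fin N → Fin (n * l) → F) (s : Fin (T * l) → F) (k : Fin n),
      f (∑ i, w i) k = ∑ j, x j ^ (k : ℕ) * e.symm (∑ i ∈ users H j, msg i j (w i) (key i s)) := by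
    intro w s k
    rw [map_sum, Finset.sum_apply, ← sum_pow_mul_relay hH hx x₀ y.injective hT _ (g s) k]
    simp only [msg, key, map_sum, LinearEquiv.symm_apply_apply]
  have hTN : T ≤ N := by lia
  have hn' : (n : ℝ) ≠ 0 := by positivity
  have hl' : (l : ℝ) ≠ 0 := by positivity
  have hrate : (l : ℝ) / ((n * l : ℕ) : ℝ) = 1 / n := by
    push_cast; field_simp
  have : Nonempty {p : Fin N × Fin K // p.2 ∈ H p.1} := by
    obtain ⟨j, hj⟩ : (H ⟨0, hN⟩).Nonempty := Finset.card_pos.1 (by rw [hH]; exact hn)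
    exact ⟨⟨(⟨0, hN⟩, j), hj⟩⟩
  have : Nonempty (Fin K) := this.map fun p => p.1.2
  refine ⟨codeScheme H hL hTN key hkey msg, ⟨?_, ?_⟩, ?_, ?_, ?_, ?_⟩
  · refine codeScheme_decodable hL hTN hkey fun w w' s s' h => f.injective (funext fun k => ?_)
    rw [hrelay w s, hrelay w' s']
    simp only [h]
  · exact codeScheme_private hL hTN hkey le_rfl hU hmsg
  · exact hrate ▸ codeScheme_RX_le hL hTN hkey
  · exact hrate ▸ codeScheme_RY_le hL hTN hkey
  · exact hrate
  · change ((T * l : ℕ) : ℝ) / ((n * l : ℕ) : ℝ) = _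
    rw [hT_def]
    push_cast
    field_simp

end HSA

theorem mainTheorem5 (F : Type u) [Field F] [Fintype F] (N K n m Tu : ℕ)
    (hn : 0 < n) (hnK : n < K) (hN : 0 < N) (hKN : K ∣ N) (hm : N * n = K * m)
    (hTu : Tu < HSA.minUsers (HSA.multipleCyclic N K n) n 1)
    (hTum : Tu + m ≤ min (N - 1) (K - n)) :
    (∃ S : HSA.Scheme F (HSA.multipleCyclic N K n),
      S.IsSecure 1 Tu ∧
      S.RX = 1 / (n : ℝ) ∧ S.RY = 1 / (n : ℝ) ∧
      S.RZ = 1 / (n : ℝ) ∧ S.RZS = ((Tu : ℝ) + m) / n) ∧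
    (∀ S : HSA.Scheme F (HSA.multipleCyclic N K n), S.IsSecure 1 Tu →
      1 / (n : ℝ) ≤ S.RX ∧ 1 / (n : ℝ) ≤ S.RY ∧
      (S.RX = 1 / (n : ℝ) → S.RY = 1 / (n : ℝ) →
        1 / (n : ℝ) ≤ S.RZ ∧ ((Tu : ℝ) + m) / n ≤ S.RZS)) := by
  have hH := HSA.card_multipleCyclic (N := N) hnK
  obtain ⟨p, hp⟩ := hKN
  have hK : 0 < K := by lia
  have hmp : p * n = m := Nat.eq_of_mul_eq_mul_left hK (by rw [← hm, hp, mul_assoc])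
  have hU : ∀ j, (HSA.users (HSA.multipleCyclic N K n) j).card = m := fun j => by
    rw [HSA.card_users_multipleCyclic hnK hp, hmp]
  have hT : Tu + m + 1 ≤ N := by
    have := hTum.trans (min_le_left _ _)
    lia
  refine ⟨?_, fun S hS => ⟨S.one_div_le_RX hS.1 hn ⟨0, hN⟩ (hH _),
    S.one_div_le_RY hS.1 hn ⟨0, hN⟩ (hH _), fun hRX _ => ⟨S.one_div_le_RZ hS hn hH hRX ⟨0, hN⟩,
      S.le_RZS hS hn hH hRX ⟨0, hK⟩ (hU _) (by lia)⟩⟩⟩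
  obtain ⟨S, hS, hRX, hRY, hRZ, hRZS⟩ :=
    HSA.exists_secure_scheme F hn hN hH (fun j => (hU j).le) hT
  exact ⟨S, hS, le_antisymm hRX (S.one_div_le_RX hS.1 hn ⟨0, hN⟩ (hH _)),
    le_antisymm hRY (S.one_div_le_RY hS.1 hn ⟨0, hN⟩ (hH _)), hRZ, hRZS⟩
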